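/- Let $A\in\mathbb R^{n\times n}$, $B\in\mathbb R^{n\times m}$, $\Xi\in\mathbb R^{n\times k}$, let $Q,Q_f\in\mathbb R^{n\times n}$ be symmetric positive semidefinite and $R\in\mathbb R^{m\times m}$ symmetric positive definite. Let $\hat w^{(1)},\dots,\hat w^{(N)}\in\mathbb R^k$ ($N\ge 1$), $\nu:=\frac1N\sum_{i=1}^N\delta_{\hat w^{(i)}}$, $\bar w:=\mathbb E_\nu[w]$, $\Sigma:=\mathbb E_\nu[ww^\top]$. Consider $x_{t+1}=Ax_t+Bu_t+\Xi w_t$, where $u_t=\pi_t(x_t)$ for a (measurable, deterministic Markov) control policy $\pi\in\Pi$, and $w_t\sim\mu_t=\gamma_t(x_t)$ for a (measurable, deterministic Markov) opponent policy $\gamma\in\Gamma$ with values in the Borel probability measures on $\mathbb R^k$. With $W_2$ the Wasserstein distance of order $2$ for the Euclidean norm, let, for $\lambda>0$ and $T\ge 1$, $$J^\lambda_{x,T}(\pi,\gamma):=\frac1T\,\mathbb E^{\pi,\gamma}\Big[x_T^\top Q_f x_T+\sum_{t=0}^{T-1}\big(x_t^\top Qx_t+u_t^\top Ru_t-\lambda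 W_2(\mu_t,\nu)^2\big)\,\Big|\,x_0=x\Big],$$ with value $-\infty$ if the expected penalty $\mathbb E^{\pi,\gamma}\big[\sum_{t<T}W_2(\mu_t,\nu)^2\,\big|\,x_0=x\big]$ is infinite, and let $$\rho(\lambda):=\limsup_{T\to\infty}\ \inf_{\pi\in\Pi}\sup_{\gamma\in\Gamma}J^\lambda_{x,T}(\pi,\gamma)$$ be the stationary cost. Put $\Phi_\lambda:=BR^{-1}B^\top-\frac1\lambda\Xi\Xi^\top$ and, for a horizon $T$, let $P_T^\lambda=Q_f$, $P_t^\lambda=Q+A^\top(I+P_{t+1}^\lambda\Phi_\lambda)^{-1}P_{t+1}^\lambda A$ for $t<T$. Let $\hat\lambda_1\in[0,\infty]$ be the infimum of the constants $\ell>0$ such that $\Phi_\lambda\succeq0$ and $(A,\Phi_\lambda^{1/2})$ is stabilizable for every $\lambda>\ell$ (with $\inf\emptyset=\infty$), let $$\hat\lambda_2:=\inf\{\lambda>0\mid \lambda I-\Xi^\top P_t^\lambda\Xi\succ0\ \text{ for all } T\ge1,\ 1\le t\le T\},$$ and let $\hat\lambda_\infty:=\max\{\hat\lambda_1,\hat\lambda_2\}$.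 Assume that $(A,B)$ is stabilizable, that $(A,Q^{1/2})$ is observable, and that $\hat\lambda_2$ is finite. Then: 1. on $(\hat\lambda_\infty,\infty)$ the stationary cost $\rho(\lambda)$ is finite and independent of the initial state $x$, and $\rho$ is a monotonically nonincreasing convex function there; 2. let $\tilde P_t,\tilde r_t$ be generated by the Riccati recursion of the standard LQG problem, $$\tilde P_t=Q+A^\top(I+\tilde P_{t+1}BR^{-1}B^\top)^{-1}\tilde P_{t+1}A,\qquad \tilde r_t=A^\top(I+\tilde P_{t+1}BR^{-1}B^\top)^{-1}(\tilde P_{t+1}\Xi\bar w+\tilde r_{t+1}),$$ with $\tilde P_T=Q_f$, $\tilde r_T=0$. For fixed $t$, the limits $\tilde P_{ss}:=\lim_{T\to\infty}\tilde P_t$ and $\tilde r_{ss}:=\lim_{T\to\infty}\tilde r_t$ exist, and for every initial state $x$ $$\lim_{\lambda\to\infty}\rho(\lambda)=\mathrm{tr}[\Xi^\top\tilde P_{ss}\Xi\Sigma]-\bar w^\top\Xi^\top\tilde P_{ss}BR^{-1}B^\top(I+\tilde P_{ss}BR^{-1}B^\top)^{-1}\tilde P_{ss}\Xi\bar w+(2\bar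 w^\top\Xi^\top-\tilde r_{ss}^\top BR^{-1}B^\top)(I+\tilde P_{ss}BR^{-1}B^\top)^{-1}\tilde r_{ss}.$$ -/

import Mathlib

open MeasureTheory ProbabilityTheory Filter Topology
open scoped ENNReal Matrix MatrixOrder

noncomputable section

/-- Data of the linear-quadratic problem `x_{t+1} = A x_t + B u_t + Ξ w_t` with state, input and
terminal weights `Q`, `R`, `Qf`, and with `N` sample disturbances `sample i`. -/
structure LQSystem (n m k N : ℕ) where
  A : Matrix (Fin n) (Fin n) ℝ
  B : Matrix (Fin n) (Fin m) ℝ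
  Xi : Matrix (Fin n) (Fin k) ℝ
  Q : Matrix (Fin n) (Fin n) ℝ
  Qf : Matrix (Fin n) (Fin n) ℝ
  R : Matrix (Fin m) (Fin m) ℝ
  sample : Fin N → Fin k → ℝ

/-- All complex eigenvalues lie in the open unit disc. -/
def IsSchurStable {n : ℕ} (M : Matrix (Fin n) (Fin n) ℝ) : Prop :=
  ∀ z ∈ spectrum ℂ (M.map (algebraMap ℝ ℂ)), ‖z‖ < 1

/-- `(A, B)` is stabilizable: some feedback gain makes `A + B K` stable. -/
def Stabilizable {n m : ℕ} (A : Matrix (Fin n) (Fin n) ℝ) (B : Matrix (Fin n) (Fin m) ℝ) : Prop :=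
  ∃ K : Matrix (Fin m) (Fin n) ℝ, IsSchurStable (A + B * K)

/-- `(A, C)` is observable: the observability matrix with block rows `C, C A, …, C A ^ (n - 1)`
has trivial kernel. -/
def Observable {n p : ℕ} (A : Matrix (Fin n) (Fin n) ℝ) (C : Matrix (Fin p) (Fin n) ℝ) : Prop :=
  ∀ x : Fin n → ℝ, (∀ j < n, (C * A ^ j) *ᵥ x = 0) → x = 0

/-- Wasserstein distance of order two, for the Euclidean norm on `ℝ^k`
(`(v - w) ⬝ᵥ (v - w)` is the squared Euclidean norm of `v - w`). -/
def wasserstein2 {k : ℕ} (μ ν : Measure (Fin k → ℝ)) : ℝ≥0∞ :=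
  ⨅ (η : Measure ((Fin k → ℝ) × (Fin k → ℝ))) (_ : η.map Prod.fst = μ) (_ : η.map Prod.snd = ν),
    (∫⁻ p, ENNReal.ofReal ((p.1 - p.2) ⬝ᵥ (p.1 - p.2)) ∂η) ^ (1 / 2 : ℝ)

/-- Deterministic Markov control policies. -/
def ControlPolicy (n m : ℕ) : Type :=
  {π : ℕ → (Fin n → ℝ) → (Fin m → ℝ) // ∀ t, Measurable (π t)}

/-- Deterministic Markov opponent policies: at each stage the current state is mapped (measurably)
to a probability distribution of the disturbance. -/
def OpponentPolicy (n k : ℕ) : Type :=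
  {γ : ℕ → Kernel (Fin n → ℝ) (Fin k → ℝ) // ∀ t, IsMarkovKernel (γ t)}

namespace LQSystem

variable {n m k N : ℕ} (S : LQSystem n m k N)

/-- The empirical distribution of the samples. -/
def nu : Measure (Fin k → ℝ) := (N : ℝ≥0∞)⁻¹ • ∑ i, Measure.dirac (S.sample i)

/-- The mean of the empirical distribution. -/
def wbar : Fin k → ℝ := (N : ℝ)⁻¹ • ∑ i, S.sample i

/-- The matrix `E[w wᵀ]` of the empirical distribution. -/
def Sigma : Matrix (Fin k) (Fin k) ℝ :=
  (N : ℝ)⁻¹ • ∑ i, Matrix.vecMulVec (S.sample i) (S.sample i)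

/-- The law of the state `x_t` under the two policies, when `x_0 = x`. -/
def stateLaw (π : ControlPolicy n m) (γ : OpponentPolicy n k) (x : Fin n → ℝ) :
    ℕ → Measure (Fin n → ℝ)
  | 0 => Measure.dirac x
  | t + 1 => (stateLaw π γ x t ⊗ₘ γ.1 t).map
      fun p => S.A *ᵥ p.1 + S.B *ᵥ π.1 t p.1 + S.Xi *ᵥ p.2

/-- Expected value of `x_Tᵀ Qf x_T + ∑_{t<T} (x_tᵀ Q x_t + u_tᵀ R u_t)`. -/
def quadraticCost (T : ℕ) (x : Fin n → ℝ) (π : ControlPolicy n m) (γ : OpponentPolicy n k) :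
    ℝ≥0∞ :=
  (∫⁻ y, ENNReal.ofReal (y ⬝ᵥ S.Qf *ᵥ y) ∂(S.stateLaw π γ x T)) +
    ∑ t ∈ Finset.range T,
      ∫⁻ y, ENNReal.ofReal (y ⬝ᵥ S.Q *ᵥ y + π.1 t y ⬝ᵥ S.R *ᵥ π.1 t y) ∂(S.stateLaw π γ x t)

/-- Expected value of `∑_{t<T} W₂(μ_t, ν)²`. -/
def wassersteinPenalty (T : ℕ) (x : Fin n → ℝ) (π : ControlPolicy n m)
    (γ : OpponentPolicy n k) : ℝ≥0∞ :=
  ∑ t ∈ Finset.range T, ∫⁻ y, wasserstein2 (γ.1 t y) S.nu ^ 2 ∂(S.stateLaw π γ x t)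

/-- The penalized cost over `T` stages. An opponent who incurs an infinite expected penalty gets
the value `-∞` (in `EReal`, `⊤ - ⊤ = ⊥`), so it is never chosen in the maximization. -/
def penalizedCost (lam : ℝ) (T : ℕ) (x : Fin n → ℝ) (π : ControlPolicy n m)
    (γ : OpponentPolicy n k) : EReal :=
  ((S.quadraticCost T x π γ : EReal) -
    ((ENNReal.ofReal lam * S.wassersteinPenalty T x π γ : ℝ≥0∞) : EReal)) / (T : EReal)

/-- The minimax value of the `T`-stage problem. -/
def minimaxValue (lam : ℝ) (T : ℕ) (x : Fin n → ℝ) : EReal :=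
  ⨅ π : ControlPolicy n m, ⨆ γ : OpponentPolicy n k, S.penalizedCost lam T x π γ

/-- The stationary (steady-state average) cost, for the initial state `x`. -/
def stationaryCost (lam : ℝ) (x : Fin n → ℝ) : EReal :=
  limsup (fun T : ℕ => S.minimaxValue lam T x) atTop

/-- `B R⁻¹ Bᵀ`. -/
def BRB : Matrix (Fin n) (Fin n) ℝ := S.B * S.R⁻¹ * S.Bᵀ

/-- `Φ = B R⁻¹ Bᵀ - (1/λ) Ξ Ξᵀ`. -/
def Phi (lam : ℝ) : Matrix (Fin n) (Fin n) ℝ := S.BRB - (1 / lam) • (S.Xi * S.Xiᵀ)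

/-- The Riccati recursion, indexed by the number of stages to go: `P_t^λ` for the horizon `T` is
`riccatiP lam (T - t)`. -/
def riccatiP (lam : ℝ) : ℕ → Matrix (Fin n) (Fin n) ℝ
  | 0 => S.Qf
  | s + 1 => S.Q + S.Aᵀ * (1 + riccatiP lam s * S.Phi lam)⁻¹ * riccatiP lam s * S.A

/-- `Φ ⪰ 0` and `(A, Φ^{1/2})` is stabilizable. -/
def PhiAdmissible (lam : ℝ) : Prop :=
  (S.Phi lam).PosSemidef ∧ Stabilizable S.A (CFC.sqrt (S.Phi lam))

/-- `λ̂₁`: the least constant beyond which `PhiAdmissible` holds (`⊤` if there is none). -/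
def lamHat1 : EReal :=
  sInf ((fun l : ℝ => (l : EReal)) '' {l | 0 < l ∧ ∀ lam > l, S.PhiAdmissible lam})

/-- `λ̂₂`: the infimum of the `λ > 0` with `λ I - Ξᵀ P_t^λ Ξ ≻ 0` for all `T ≥ 1`, `1 ≤ t ≤ T`
(`⊤` if there is none). -/
def lamHat2 : EReal :=
  sInf ((fun l : ℝ => (l : EReal)) '' {l | 0 < l ∧ ∀ T ≥ 1, ∀ t, 1 ≤ t → t ≤ T →
    (l • (1 : Matrix (Fin k) (Fin k) ℝ) - S.Xiᵀ * S.riccatiP l (T - t) * S.Xi).PosDef})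

/-- `λ̂_∞ = max {λ̂₁, λ̂₂}`. -/
def lamHatInf : EReal := max S.lamHat1 S.lamHat2

/-- The Riccati recursion of the standard LQG problem, indexed by the number of stages to go. -/
def lqgP : ℕ → Matrix (Fin n) (Fin n) ℝ
  | 0 => S.Qf
  | s + 1 => S.Q + S.Aᵀ * (1 + lqgP s * S.BRB)⁻¹ * lqgP s * S.A

/-- The linear coefficient of the standard LQG value function, indexed by the number of stages
to go. -/
def lqgr : ℕ → Fin n → ℝ
  | 0 => 0
  | s + 1 => (S.Aᵀ * (1 + S.lqgP s * S.BRB)⁻¹) *ᵥ ((S.lqgP s * S.Xi) *ᵥ S.wbar + lqgr s)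

/-- The average cost of the standard LQG problem, for the steady-state values `P` and `r` of its
Riccati recursion. -/
def lqgAverageCost (P : Matrix (Fin n) (Fin n) ℝ) (r : Fin n → ℝ) : ℝ :=
  (S.Xiᵀ * P * S.Xi * S.Sigma).trace
    - S.wbar ⬝ᵥ (S.Xiᵀ * P * S.BRB * (1 + P * S.BRB)⁻¹ * P * S.Xi) *ᵥ S.wbar
    + ((2 : ℝ) • (S.Xi *ᵥ S.wbar) - S.BRBᵀ *ᵥ r) ⬝ᵥ ((1 + P * S.BRB)⁻¹ *ᵥ r)

end LQSystem

end

/-! The game with `T` stages is solved exactly by dynamic programming. Above a feasible `l` the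
penalized payoff is strictly concave in the displacement of each sample, so its maximum is again a
quadratic function (`maxStep`). Averaging over the samples and minimizing over the control gives
another one (`lqgStep`). `minimaxValue_eq` identifies the value of the game with the resulting
function `robustValue`, divided by `T`: weak Kantorovich duality gives the upper bound, an opponent
who displaces the samples the lower one.

The minimax recursion is not shown to converge. Its value is squeezed against the LQG value instead.
An opponent who plays `ν` itself gives the lower bound. For the upper bound, `robustValue_add_le`
splits the state into an LQG trajectory and a deviation driven by the displacements, and
`robustValue_le` concludes that the minimax value is at most `λ / (λ - l)` times the LQG value. The
LQG value over `T` tends to the average cost `ℓ`: the Riccati matrices converge by stabilizability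
and observability, the linear terms by stability of the closed loop, and the increments of the
constant by Cesàro averaging. Hence the stationary cost lies between `ℓ` and `λ / (λ - l) * ℓ` for
every initial state, which gives finiteness and the limit `λ → ∞`.

The values are jointly convex in the penalty parameter and the state (`robustValue_convex`), and
this passes to the stationary cost. At a fixed state it is convexity in `λ`; at a fixed `λ` it gives
a bounded convex function on the state space, which must be constant. Monotonicity is the sign of
the penalty. -/

noncomputable section

open Matrix

/-! ### Positive semidefinite matrices as quadratic forms. -/

namespace Matrix

variable {a b : ℕ}

theorem dotProduct_transpose_mulVec' (M : Matrix (Fin a) (Fin b) ℝ) (x : Fin b → ℝ)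
    (y : Fin a → ℝ) : x ⬝ᵥ Mᵀ *ᵥ y = y ⬝ᵥ M *ᵥ x := by
  rw [dotProduct_mulVec, vecMul_transpose, dotProduct_comm]

theorem PosSemidef.transpose_eq {P : Matrix (Fin a) (Fin a) ℝ} (hP : P.PosSemidef) : Pᵀ = P := by
  simpa [IsHermitian, conjTranspose_eq_transpose_of_trivial] using hP.isHermitian

theorem PosSemidef.dot_comm {P : Matrix (Fin a) (Fin a) ℝ} (hP : P.PosSemidef)
    (x y : Fin a → ℝ) : x ⬝ᵥ P *ᵥ y = y ⬝ᵥ P *ᵥ x := by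
  conv_lhs => rw [← hP.transpose_eq]
  exact dotProduct_transpose_mulVec' P x y

theorem PosSemidef.dot_nonneg {P : Matrix (Fin a) (Fin a) ℝ} (hP : P.PosSemidef)
    (x : Fin a → ℝ) : 0 ≤ x ⬝ᵥ P *ᵥ x := by
  simpa using hP.dotProduct_mulVec_nonneg x

theorem PosSemidef.mulVec_eq_zero {P : Matrix (Fin a) (Fin a) ℝ} (hP : P.PosSemidef)
    {x : Fin a → ℝ} (h : x ⬝ᵥ P *ᵥ x = 0) : P *ᵥ x = 0 :=
  (hP.dotProduct_mulVec_zero_iff x).1 (by simpa using h)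

theorem PosDef.dot_pos {P : Matrix (Fin a) (Fin a) ℝ} (hP : P.PosDef)
    {x : Fin a → ℝ} (hx : x ≠ 0) : 0 < x ⬝ᵥ P *ᵥ x := by
  simpa using hP.dotProduct_mulVec_pos hx

theorem posSemidef_of_dot {P : Matrix (Fin a) (Fin a) ℝ} (h1 : Pᵀ = P)
    (h2 : ∀ x : Fin a → ℝ, 0 ≤ x ⬝ᵥ P *ᵥ x) : P.PosSemidef :=
  .of_dotProduct_mulVec_nonneg (by simpa [IsHermitian, conjTranspose_eq_transpose_of_trivial])
    (by simpa using h2)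

theorem posDef_of_dot {P : Matrix (Fin a) (Fin a) ℝ} (h1 : Pᵀ = P)
    (h2 : ∀ x : Fin a → ℝ, x ≠ 0 → 0 < x ⬝ᵥ P *ᵥ x) : P.PosDef :=
  .of_dotProduct_mulVec_pos (by simpa [IsHermitian, conjTranspose_eq_transpose_of_trivial])
    (by simpa using h2)

/-- A kernel vector satisfies `y = -P W y`, so `yᵀ W y = -(W y)ᵀ P (W y)`. Both forms are
nonnegative, hence zero, so `P W y = 0` and `y = 0`. -/
theorem PosSemidef.isUnit_one_add_mul {P W : Matrix (Fin a) (Fin a) ℝ} (hP : P.PosSemidef)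
    (hW : W.PosSemidef) : IsUnit (1 + P * W) := by
  rw [← mulVec_injective_iff_isUnit]
  refine (injective_iff_map_eq_zero (1 + P * W).mulVecLin).2 fun y hy => ?_
  rw [mulVecLin_apply] at hy
  have h1 : y = -(P *ᵥ (W *ᵥ y)) := by
    have : y + P *ᵥ (W *ᵥ y) = 0 := by simpa [add_mulVec] using hy
    exact eq_neg_of_add_eq_zero_left this
  have h2 : y ⬝ᵥ W *ᵥ y = -((W *ᵥ y) ⬝ᵥ P *ᵥ (W *ᵥ y)) := by
    conv_lhs => rw [dotProduct_comm]
    conv_lhs => arg 2; rw [h1]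
    simp
  have h3 := hW.dot_nonneg y
  have h4 := hP.dot_nonneg (W *ᵥ y)
  have h5 := hP.mulVec_eq_zero (x := W *ᵥ y) (by linarith)
  rw [h1, h5, neg_zero]

/-- For positive semidefinite matrices, `(1 + P W)⁻¹ P` is symmetric. -/
theorem PosSemidef.inv_one_add_mul_mul_comm {P W : Matrix (Fin a) (Fin a) ℝ} (hP : P.PosSemidef)
    (hW : W.PosSemidef) : P * ((1 + P * W)⁻¹)ᵀ = (1 + P * W)⁻¹ * P := by
  have hu := (isUnit_iff_isUnit_det _).1 (hP.isUnit_one_add_mul hW)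
  have h1 : (1 + P * W)ᵀ = 1 + W * P := by
    simp [transpose_mul, hP.transpose_eq, hW.transpose_eq]
  have hu' : IsUnit (1 + W * P).det := by rw [← h1, det_transpose]; exact hu
  rw [transpose_nonsing_inv, h1]
  have h2 : (1 + P * W) * P = P * (1 + W * P) := by noncomm_ring
  calc P * (1 + W * P)⁻¹ = (1 + P * W)⁻¹ * ((1 + P * W) * P) * (1 + W * P)⁻¹ := by
        rw [nonsing_inv_mul_cancel_left _ _ hu]
    _ = _ := by
        rw [h2, ← Matrix.mul_assoc, Matrix.mul_assoc, Matrix.mul_nonsing_inv _ hu',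
          Matrix.mul_one]

end Matrix

/-- The quadratic function `x ↦ xᵀ P x + 2 rᵀ x + z`. -/
structure QuadFun (n : ℕ) where
  P : Matrix (Fin n) (Fin n) ℝ
  r : Fin n → ℝ
  z : ℝ

namespace QuadFun

variable {n : ℕ}

/-- The value of a quadratic function. -/
def eval (f : QuadFun n) (x : Fin n → ℝ) : ℝ := x ⬝ᵥ f.P *ᵥ x + 2 * (f.r ⬝ᵥ x) + f.z

theorem eval_add (f : QuadFun n) (hP : f.P.PosSemidef) (x d : Fin n → ℝ) :
    f.eval (x + d) = f.eval x + 2 * (d ⬝ᵥ (f.P *ᵥ x + f.r)) + d ⬝ᵥ f.P *ᵥ d := by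
  simp only [eval, mulVec_add, dotProduct_add, add_dotProduct]
  rw [hP.dot_comm x d, dotProduct_comm f.r d]
  ring

theorem continuous_eval (f : QuadFun n) : Continuous f.eval := by
  unfold eval
  fun_prop

end QuadFun

/-! ### One LQG stage: minimization over the control and averaging over the samples. -/

namespace LQSystem

variable {n m k N : ℕ} (S : LQSystem n m k N)

/-- The running cost. -/
def stageCost (x : Fin n → ℝ) (u : Fin m → ℝ) : ℝ := x ⬝ᵥ S.Q *ᵥ x + u ⬝ᵥ S.R *ᵥ u

/-- Averages over the samples. -/
def avg (_S : LQSystem n m k N) (f : Fin N → ℝ) : ℝ := (N : ℝ)⁻¹ * ∑ i, f i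

/-- `(1 + P B R⁻¹ Bᵀ)⁻¹`. -/
def G (P : Matrix (Fin n) (Fin n) ℝ) : Matrix (Fin n) (Fin n) ℝ := (1 + P * S.BRB)⁻¹

/-- The optimal control for the terminal cost `y ↦ yᵀ P y + 2 qᵀ y`. -/
def optControl (P : Matrix (Fin n) (Fin n) ℝ) (q x : Fin n → ℝ) : Fin m → ℝ :=
  -(S.R⁻¹ *ᵥ (S.Bᵀ *ᵥ (S.G P *ᵥ (P *ᵥ (S.A *ᵥ x) + q))))

/-- Minimization over the control and averaging over the samples. -/
def lqgStep (f : QuadFun n) : QuadFun n where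
  P := S.Q + S.Aᵀ * S.G f.P * f.P * S.A
  r := (S.Aᵀ * S.G f.P) *ᵥ ((f.P * S.Xi) *ᵥ S.wbar + f.r)
  z := f.z + S.lqgAverageCost f.P f.r

theorem avg_mono {f g : Fin N → ℝ} (h : ∀ i, f i ≤ g i) : S.avg f ≤ S.avg g := by
  unfold avg
  gcongr with i
  exact h i

theorem avg_add (f g : Fin N → ℝ) : S.avg (fun i => f i + g i) = S.avg f + S.avg g := by
  simp [avg, Finset.sum_add_distrib, mul_add]

theorem avg_mul (c : ℝ) (f : Fin N → ℝ) : S.avg (fun i => c * f i) = c * S.avg f := by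
  simp only [avg, ← Finset.mul_sum]; ring

theorem avg_const (hN : 0 < N) (c : ℝ) : S.avg (fun _ => c) = c := by
  have : (N : ℝ) ≠ 0 := by positivity
  simp [avg, this]

theorem avg_nonneg {f : Fin N → ℝ} (h : ∀ i, 0 ≤ f i) : 0 ≤ S.avg f :=
  mul_nonneg (by positivity) (Finset.sum_nonneg fun i _ => h i)

theorem posSemidef_BRB (hR : S.R.PosDef) : S.BRB.PosSemidef := by
  have := hR.posSemidef.inv.mul_mul_conjTranspose_same S.B
  rwa [conjTranspose_eq_transpose_of_trivial] at this

theorem stageCost_nonneg (hQ : S.Q.PosSemidef) (hR : S.R.PosDef) (x : Fin n → ℝ)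
    (u : Fin m → ℝ) : 0 ≤ S.stageCost x u :=
  add_nonneg (hQ.dot_nonneg x) (hR.posSemidef.dot_nonneg u)

variable {S}

theorem G_mul_comm (hR : S.R.PosDef) {P : Matrix (Fin n) (Fin n) ℝ} (hP : P.PosSemidef) :
    P * (S.G P)ᵀ = S.G P * P :=
  hP.inv_one_add_mul_mul_comm (S.posSemidef_BRB hR)

theorem mul_G (hR : S.R.PosDef) {P : Matrix (Fin n) (Fin n) ℝ} (hP : P.PosSemidef) :
    (1 + P * S.BRB) * S.G P = 1 :=
  mul_nonsing_inv _ ((isUnit_iff_isUnit_det _).1 (hP.isUnit_one_add_mul (S.posSemidef_BRB hR)))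

theorem G_mul (hR : S.R.PosDef) {P : Matrix (Fin n) (Fin n) ℝ} (hP : P.PosSemidef) :
    S.G P * (1 + P * S.BRB) = 1 :=
  nonsing_inv_mul _ ((isUnit_iff_isUnit_det _).1 (hP.isUnit_one_add_mul (S.posSemidef_BRB hR)))

theorem transpose_G (hR : S.R.PosDef) {P : Matrix (Fin n) (Fin n) ℝ} (hP : P.PosSemidef) :
    (S.G P)ᵀ = 1 - S.BRB * S.G P * P := by
  have h : S.G P = 1 - S.G P * P * S.BRB := by
    have := S.G_mul hR hP
    rw [Matrix.mul_add, Matrix.mul_one, ← Matrix.mul_assoc] at this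
    exact eq_sub_of_add_eq this
  conv_lhs => rw [h]
  rw [transpose_sub, transpose_mul, transpose_mul, hP.transpose_eq, G_mul_comm hR hP,
    (S.posSemidef_BRB hR).transpose_eq, transpose_one, Matrix.mul_assoc]

/-- Completion of the square in the control. -/
theorem control_identity (hR : S.R.PosDef) {P : Matrix (Fin n) (Fin n) ℝ} (hP : P.PosSemidef)
    (q x : Fin n → ℝ) (d : Fin m → ℝ) :
    (S.optControl P q x + d) ⬝ᵥ S.R *ᵥ (S.optControl P q x + d)
      + (QuadFun.mk P q 0).eval (S.A *ᵥ x + S.B *ᵥ (S.optControl P q x + d))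
    = (QuadFun.mk (S.Aᵀ * S.G P * P * S.A) ((S.Aᵀ * S.G P) *ᵥ q)
        (-(q ⬝ᵥ S.BRB *ᵥ (S.G P *ᵥ q)))).eval x
      + (d ⬝ᵥ S.R *ᵥ d + (S.B *ᵥ d) ⬝ᵥ P *ᵥ (S.B *ᵥ d)) := by
  set u := S.optControl P q x with hu
  -- `p` is the costate: it equals the half gradient `P y + q` at the optimal successor `y`.
  -- Stationarity `R u = -Bᵀ p` then cancels every term linear in `d`.
  obtain ⟨p, hp⟩ : ∃ p, p = S.G P *ᵥ (P *ᵥ (S.A *ᵥ x) + q) := ⟨_, rfl⟩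
  have hRu : S.R *ᵥ u = -(S.Bᵀ *ᵥ p) := by
    rw [hu, optControl, ← hp, mulVec_neg, mulVec_mulVec,
      mul_nonsing_inv _ ((isUnit_iff_isUnit_det _).1 hR.isUnit), one_mulVec]
  have hBu : S.B *ᵥ u = -(S.BRB *ᵥ p) := by
    rw [hu, optControl, ← hp, BRB, mulVec_neg, mulVec_mulVec, mulVec_mulVec]
  obtain ⟨y, hy⟩ : ∃ y, y = S.A *ᵥ x + S.B *ᵥ u := ⟨_, rfl⟩
  have hpy : p = P *ᵥ y + q := by
    have h1 : (1 + P * S.BRB) *ᵥ p = P *ᵥ (S.A *ᵥ x) + q := by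
      rw [hp, mulVec_mulVec, mul_G hR hP, one_mulVec]
    rw [add_mulVec, one_mulVec, ← mulVec_mulVec] at h1
    have h2 : P *ᵥ y = P *ᵥ (S.A *ᵥ x) - P *ᵥ (S.BRB *ᵥ p) := by
      rw [hy, hBu, mulVec_add, mulVec_neg, sub_eq_add_neg]
    rw [h2, sub_add_eq_add_sub, ← h1]
    abel
  have e1 : S.A *ᵥ x + S.B *ᵥ (u + d) = y + S.B *ᵥ d := by rw [mulVec_add, hy]; abel
  rw [e1, QuadFun.eval_add _ hP]
  have e2 : (u + d) ⬝ᵥ S.R *ᵥ (u + d) = u ⬝ᵥ S.R *ᵥ u + 2 * (d ⬝ᵥ S.R *ᵥ u)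
      + d ⬝ᵥ S.R *ᵥ d := by
    simp only [mulVec_add, dotProduct_add, add_dotProduct]
    rw [hR.posSemidef.dot_comm u d]; ring
  have e3 : d ⬝ᵥ S.R *ᵥ u = -((S.B *ᵥ d) ⬝ᵥ p) := by
    rw [hRu, dotProduct_neg, dotProduct_transpose_mulVec', dotProduct_comm]
  have e4 : u ⬝ᵥ S.R *ᵥ u = p ⬝ᵥ S.BRB *ᵥ p := by
    rw [hRu, dotProduct_neg, dotProduct_transpose_mulVec', hBu, dotProduct_neg, neg_neg]
  rw [e2, e3, e4]
  simp only [← hpy]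
  have hval : p ⬝ᵥ S.BRB *ᵥ p + (QuadFun.mk P q 0).eval y
      = (QuadFun.mk (S.Aᵀ * S.G P * P * S.A) ((S.Aᵀ * S.G P) *ᵥ q)
        (-(q ⬝ᵥ S.BRB *ᵥ (S.G P *ᵥ q)))).eval x := by
    have h1 : (QuadFun.mk P q 0).eval y = y ⬝ᵥ p + y ⬝ᵥ q := by
      simp only [QuadFun.eval]
      rw [hpy, dotProduct_add, dotProduct_comm q y, add_zero]; ring
    have h2 : y = S.A *ᵥ x - S.BRB *ᵥ p := by rw [hy, hBu]; abel
    rw [h1, h2, sub_dotProduct, sub_dotProduct, dotProduct_comm (S.BRB *ᵥ p) p,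
      dotProduct_comm (S.BRB *ᵥ p) q]
    simp only [QuadFun.eval]
    have h3 : x ⬝ᵥ (S.Aᵀ * S.G P * P * S.A) *ᵥ x
        = (S.A *ᵥ x) ⬝ᵥ S.G P *ᵥ (P *ᵥ (S.A *ᵥ x)) := by
      simp only [← mulVec_mulVec]
      rw [dotProduct_transpose_mulVec', dotProduct_comm]
    have h4 : ((S.Aᵀ * S.G P) *ᵥ q) ⬝ᵥ x = (S.A *ᵥ x) ⬝ᵥ S.G P *ᵥ q := by
      simp only [← mulVec_mulVec]
      rw [dotProduct_comm, dotProduct_transpose_mulVec', dotProduct_comm]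
    have h5 : q ⬝ᵥ S.BRB *ᵥ (S.G P *ᵥ (P *ᵥ (S.A *ᵥ x)))
        = (S.A *ᵥ x) ⬝ᵥ q - (S.A *ᵥ x) ⬝ᵥ S.G P *ᵥ q := by
      rw [← dotProduct_transpose_mulVec' (S.G P) q, transpose_G hR hP, sub_mulVec, one_mulVec,
        dotProduct_sub, ← mulVec_mulVec, ← mulVec_mulVec,
        dotProduct_comm (S.A *ᵥ x) q]
      ring
    rw [h3, h4, hp]
    simp only [mulVec_add, dotProduct_add]
    rw [h5]
    ring
  linarith

theorem control_identity_opt (hR : S.R.PosDef) {P : Matrix (Fin n) (Fin n) ℝ} (hP : P.PosSemidef)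
    (q x : Fin n → ℝ) :
    S.optControl P q x ⬝ᵥ S.R *ᵥ S.optControl P q x
      + (QuadFun.mk P q 0).eval (S.A *ᵥ x + S.B *ᵥ S.optControl P q x)
    = (QuadFun.mk (S.Aᵀ * S.G P * P * S.A) ((S.Aᵀ * S.G P) *ᵥ q)
        (-(q ⬝ᵥ S.BRB *ᵥ (S.G P *ᵥ q)))).eval x := by
  simpa using control_identity hR hP q x 0

theorem control_le (hR : S.R.PosDef) {P : Matrix (Fin n) (Fin n) ℝ} (hP : P.PosSemidef)
    (q x : Fin n → ℝ) (u : Fin m → ℝ) :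
    (QuadFun.mk (S.Aᵀ * S.G P * P * S.A) ((S.Aᵀ * S.G P) *ᵥ q)
        (-(q ⬝ᵥ S.BRB *ᵥ (S.G P *ᵥ q)))).eval x
    ≤ u ⬝ᵥ S.R *ᵥ u + (QuadFun.mk P q 0).eval (S.A *ᵥ x + S.B *ᵥ u) := by
  have h := control_identity hR hP q x (u - S.optControl P q x)
  rw [add_sub_cancel] at h
  have h1 := hR.posSemidef.dot_nonneg (u - S.optControl P q x)
  have h2 := hP.dot_nonneg (S.B *ᵥ (u - S.optControl P q x))
  linarith

theorem posSemidef_lqgStep (hQ : S.Q.PosSemidef) (hR : S.R.PosDef) {f : QuadFun n}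
    (hP : f.P.PosSemidef) : (S.lqgStep f).P.PosSemidef := by
  refine hQ.add (posSemidef_of_dot ?_ fun x => ?_)
  · simp only [transpose_mul, transpose_transpose, hP.transpose_eq]
    rw [← Matrix.mul_assoc, ← Matrix.mul_assoc, Matrix.mul_assoc S.Aᵀ, G_mul_comm hR hP]
    simp only [Matrix.mul_assoc]
  -- For `q = 0` the form is the optimal value of a nonnegative cost.
  · have h := control_identity_opt hR hP 0 x
    simp only [QuadFun.eval, mulVec_zero, zero_dotProduct, mul_zero, neg_zero, add_zero] at h
    rw [← h]
    exact add_nonneg (hR.posSemidef.dot_nonneg _) (hP.dot_nonneg _)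

/-- A quadratic function sees the disturbance only through two moments: the mean shifts the linear
term, the second moment contributes a trace. -/
theorem avg_eval (hN : 0 < N) {f : QuadFun n} (hP : f.P.PosSemidef) (y : Fin n → ℝ) :
    S.avg (fun i => f.eval (y + S.Xi *ᵥ S.sample i))
      = (QuadFun.mk f.P ((f.P * S.Xi) *ᵥ S.wbar + f.r) 0).eval y + f.z
        + (S.Xiᵀ * f.P * S.Xi * S.Sigma).trace + 2 * (f.r ⬝ᵥ S.Xi *ᵥ S.wbar) := by
  have h1 : ∀ v : Fin k → ℝ, S.avg (fun i => v ⬝ᵥ S.sample i) = v ⬝ᵥ S.wbar := by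
    intro v
    rw [avg, wbar, dotProduct_smul, dotProduct_sum, smul_eq_mul]
  have h2 : S.avg (fun i => (S.Xi *ᵥ S.sample i) ⬝ᵥ f.P *ᵥ (S.Xi *ᵥ S.sample i))
      = (S.Xiᵀ * f.P * S.Xi * S.Sigma).trace := by
    rw [avg, Sigma, Matrix.mul_smul, trace_smul, smul_eq_mul, Matrix.mul_sum, trace_sum]
    congr 1
    refine Finset.sum_congr rfl fun i _ => ?_
    rw [mul_vecMulVec, trace_vecMulVec, ← mulVec_mulVec, ← mulVec_mulVec, dotProduct_comm _ (S.sample i),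
      dotProduct_transpose_mulVec', dotProduct_comm]
  have h3 : (fun i => f.eval (y + S.Xi *ᵥ S.sample i))
      = fun i => (f.eval y + 2 * ((S.Xiᵀ *ᵥ (f.P *ᵥ y + f.r)) ⬝ᵥ S.sample i))
        + (S.Xi *ᵥ S.sample i) ⬝ᵥ f.P *ᵥ (S.Xi *ᵥ S.sample i) := by
    funext i
    rw [f.eval_add hP, dotProduct_comm (S.Xiᵀ *ᵥ _), dotProduct_transpose_mulVec',
      dotProduct_comm (S.Xi *ᵥ _)]
  rw [h3, avg_add, avg_add, avg_const S hN, avg_mul, h1, h2]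
  have h4 : (S.Xiᵀ *ᵥ (f.P *ᵥ y + f.r)) ⬝ᵥ S.wbar
      = ((f.P * S.Xi) *ᵥ S.wbar) ⬝ᵥ y + f.r ⬝ᵥ S.Xi *ᵥ S.wbar := by
    rw [dotProduct_comm, dotProduct_transpose_mulVec', add_dotProduct, ← mulVec_mulVec,
      dotProduct_comm (f.P *ᵥ y), hP.dot_comm, dotProduct_comm y]
  rw [h4]
  simp only [QuadFun.eval, add_dotProduct]
  ring

/-- This is where the formula of `lqgAverageCost` comes from. With `a = Ξ w̄` and `q = P a + r`,
each of the two cross terms of `qᵀ B R⁻¹ Bᵀ G q` equals `r·a - a·G r`; removing both from `2 r·a`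
leaves `2 a·G r`. -/
theorem lqgStep_eval (hR : S.R.PosDef) {f : QuadFun n} (hP : f.P.PosSemidef) (x : Fin n → ℝ) :
    (S.lqgStep f).eval x = x ⬝ᵥ S.Q *ᵥ x
      + (QuadFun.mk (S.Aᵀ * S.G f.P * f.P * S.A)
        ((S.Aᵀ * S.G f.P) *ᵥ ((f.P * S.Xi) *ᵥ S.wbar + f.r))
        (-(((f.P * S.Xi) *ᵥ S.wbar + f.r) ⬝ᵥ
          S.BRB *ᵥ (S.G f.P *ᵥ ((f.P * S.Xi) *ᵥ S.wbar + f.r))))).eval x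
      + f.z + (S.Xiᵀ * f.P * S.Xi * S.Sigma).trace + 2 * (f.r ⬝ᵥ S.Xi *ᵥ S.wbar) := by
  have hBRB := S.posSemidef_BRB hR
  set a := S.Xi *ᵥ S.wbar with ha
  have hq : (f.P * S.Xi) *ᵥ S.wbar = f.P *ᵥ a := by rw [← mulVec_mulVec]
  have h1 : f.r ⬝ᵥ S.BRB *ᵥ (S.G f.P *ᵥ (f.P *ᵥ a)) = f.r ⬝ᵥ a - a ⬝ᵥ S.G f.P *ᵥ f.r := by
    rw [← dotProduct_transpose_mulVec' (S.G f.P) f.r, transpose_G hR hP, sub_mulVec, one_mulVec,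
      dotProduct_sub, ← mulVec_mulVec, ← mulVec_mulVec]
    ring
  have h2 : (f.P *ᵥ a) ⬝ᵥ S.BRB *ᵥ (S.G f.P *ᵥ f.r) = f.r ⬝ᵥ a - a ⬝ᵥ S.G f.P *ᵥ f.r := by
    have h := mul_G hR hP
    rw [Matrix.add_mul, Matrix.one_mul] at h
    rw [dotProduct_comm, hP.dot_comm, mulVec_mulVec, mulVec_mulVec,
      eq_sub_of_add_eq' h, sub_mulVec, one_mulVec, dotProduct_sub, dotProduct_comm a f.r]
  have h3 : S.wbar ⬝ᵥ (S.Xiᵀ * f.P * S.BRB * (1 + f.P * S.BRB)⁻¹ * f.P * S.Xi) *ᵥ S.wbar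
      = (f.P *ᵥ a) ⬝ᵥ S.BRB *ᵥ (S.G f.P *ᵥ (f.P *ᵥ a)) := by
    simp only [← mulVec_mulVec]
    rw [dotProduct_transpose_mulVec', dotProduct_comm, hP.dot_comm, dotProduct_comm]
    rfl
  simp only [lqgStep, QuadFun.eval, lqgAverageCost, add_mulVec, dotProduct_add, hq, h3,
    mulVec_add, add_dotProduct, sub_dotProduct, smul_dotProduct, smul_eq_mul]
  rw [h1, h2, hBRB.transpose_eq, ← ha]
  have h4 : (S.BRB *ᵥ f.r) ⬝ᵥ (1 + f.P * S.BRB)⁻¹ *ᵥ f.r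
      = f.r ⬝ᵥ S.BRB *ᵥ ((1 + f.P * S.BRB)⁻¹ *ᵥ f.r) := by
    rw [dotProduct_comm, hBRB.dot_comm]
  rw [h4]
  simp only [G]
  ring

end LQSystem

/-! ### Convexity and Young inequalities for quadratic forms. -/

namespace Matrix.PosSemidef

variable {a : ℕ} {P : Matrix (Fin a) (Fin a) ℝ}

theorem dot_convex (hP : P.PosSemidef) {α β : ℝ} (hα : 0 ≤ α) (hβ : 0 ≤ β) (hαβ : α + β = 1)
    (x y : Fin a → ℝ) : (α • x + β • y) ⬝ᵥ P *ᵥ (α • x + β • y)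
      ≤ α * (x ⬝ᵥ P *ᵥ x) + β * (y ⬝ᵥ P *ᵥ y) := by
  have h := mul_nonneg (mul_nonneg hα hβ) (hP.dot_nonneg (x - y))
  obtain rfl : β = 1 - α := by linarith
  simp only [mulVec_add, mulVec_sub, mulVec_smul, dotProduct_add, add_dotProduct, dotProduct_sub,
    sub_dotProduct, dotProduct_smul, smul_dotProduct, smul_eq_mul, hP.dot_comm y x] at h ⊢
  linarith

/-- Young's inequality: the difference of the two sides is `δ⁻¹` times the form at `δ x - y`. -/
theorem dot_add_le (hP : P.PosSemidef) {δ : ℝ} (hδ : 0 < δ) (x y : Fin a → ℝ) :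
    (x + y) ⬝ᵥ P *ᵥ (x + y) ≤ (1 + δ) * (x ⬝ᵥ P *ᵥ x) + (1 + δ⁻¹) * (y ⬝ᵥ P *ᵥ y) := by
  have h := mul_nonneg (inv_nonneg.2 hδ.le) (hP.dot_nonneg (δ • x - y))
  simp only [mulVec_add, mulVec_sub, mulVec_smul, dotProduct_add, add_dotProduct, dotProduct_sub,
    sub_dotProduct, dotProduct_smul, smul_dotProduct, smul_eq_mul, hP.dot_comm y x] at h ⊢
  have e : δ⁻¹ * (δ * (δ * x ⬝ᵥ P *ᵥ x - x ⬝ᵥ P *ᵥ y) - (δ * x ⬝ᵥ P *ᵥ y - y ⬝ᵥ P *ᵥ y))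
    = δ * (x ⬝ᵥ P *ᵥ x) - 2 * (x ⬝ᵥ P *ᵥ y) + δ⁻¹ * (y ⬝ᵥ P *ᵥ y) := by field_simp; ring
  linarith

end Matrix.PosSemidef

/-! ### The penalized stage and the comparison of value functions. -/

namespace LQSystem

variable {n m k N : ℕ} (S : LQSystem n m k N)

/-- The minimizing control for the terminal cost `f`. -/
def lqgControl (f : QuadFun n) (x : Fin n → ℝ) : Fin m → ℝ :=
  S.optControl f.P ((f.P * S.Xi) *ᵥ S.wbar + f.r) x

/-- `λ I - Ξᵀ P Ξ`. -/
def gap (lam : ℝ) (P : Matrix (Fin n) (Fin n) ℝ) : Matrix (Fin k) (Fin k) ℝ :=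
  lam • (1 : Matrix (Fin k) (Fin k) ℝ) - S.Xiᵀ * P * S.Xi

/-- `Ξ (λ I - Ξᵀ P Ξ)⁻¹ Ξᵀ`. -/
def gapInv (lam : ℝ) (P : Matrix (Fin n) (Fin n) ℝ) : Matrix (Fin n) (Fin n) ℝ :=
  S.Xi * (S.gap lam P)⁻¹ * S.Xiᵀ

/-- The worst deviation of the disturbance from a sample, for the terminal cost `f`. -/
def worst (lam : ℝ) (f : QuadFun n) (y : Fin n → ℝ) : Fin k → ℝ :=
  (S.gap lam f.P)⁻¹ *ᵥ (S.Xiᵀ *ᵥ (f.P *ᵥ y + f.r))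

/-- Maximization over the deviation of the disturbance from a sample. -/
def maxStep (lam : ℝ) (f : QuadFun n) : QuadFun n where
  P := f.P + f.P * S.gapInv lam f.P * f.P
  r := f.r + (f.P * S.gapInv lam f.P) *ᵥ f.r
  z := f.z + f.r ⬝ᵥ S.gapInv lam f.P *ᵥ f.r

/-- One step of dynamic programming for the penalized minimax problem. -/
def robustStep (lam : ℝ) (f : QuadFun n) : QuadFun n := S.lqgStep (S.maxStep lam f)

/-- The value function of the penalized minimax problem. -/
def robustValue (lam : ℝ) : ℕ → QuadFun n
  | 0 => ⟨S.Qf, 0, 0⟩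
  | s + 1 => S.robustStep lam (robustValue lam s)

/-- The value function of the standard LQG problem. -/
def lqgValue : ℕ → QuadFun n
  | 0 => ⟨S.Qf, 0, 0⟩
  | s + 1 => S.lqgStep (lqgValue s)

variable {S}

theorem lqgValue_P (s : ℕ) : (S.lqgValue s).P = S.lqgP s := by
  induction s with
  | zero => rfl
  | succ s ih => simp only [lqgValue, lqgStep, ih, lqgP, G]

theorem lqgValue_r (s : ℕ) : (S.lqgValue s).r = S.lqgr s := by
  induction s with
  | zero => rfl
  | succ s ih => simp only [lqgValue, lqgStep, ih, lqgValue_P, lqgr, G]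

theorem stageCost_add_avg (hN : 0 < N) {f : QuadFun n} (hP : f.P.PosSemidef) (x : Fin n → ℝ)
    (u : Fin m → ℝ) :
    S.stageCost x u + S.avg (fun i => f.eval (S.A *ᵥ x + S.B *ᵥ u + S.Xi *ᵥ S.sample i))
      = x ⬝ᵥ S.Q *ᵥ x + (u ⬝ᵥ S.R *ᵥ u +
        (QuadFun.mk f.P ((f.P * S.Xi) *ᵥ S.wbar + f.r) 0).eval (S.A *ᵥ x + S.B *ᵥ u)) + f.z
        + (S.Xiᵀ * f.P * S.Xi * S.Sigma).trace + 2 * (f.r ⬝ᵥ S.Xi *ᵥ S.wbar) := by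
  rw [avg_eval hN hP, stageCost]
  ring

theorem lqgStep_eq (hN : 0 < N) (hR : S.R.PosDef) {f : QuadFun n} (hP : f.P.PosSemidef)
    (x : Fin n → ℝ) :
    S.stageCost x (S.lqgControl f x) + S.avg (fun i =>
      f.eval (S.A *ᵥ x + S.B *ᵥ S.lqgControl f x + S.Xi *ᵥ S.sample i))
      = (S.lqgStep f).eval x := by
  rw [stageCost_add_avg hN hP, lqgStep_eval hR hP, lqgControl, control_identity_opt hR hP]

theorem lqgStep_le (hN : 0 < N) (hR : S.R.PosDef) {f : QuadFun n} (hP : f.P.PosSemidef)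
    (x : Fin n → ℝ) (u : Fin m → ℝ) :
    (S.lqgStep f).eval x ≤ S.stageCost x u + S.avg (fun i =>
      f.eval (S.A *ᵥ x + S.B *ᵥ u + S.Xi *ᵥ S.sample i)) := by
  rw [stageCost_add_avg hN hP, lqgStep_eval hR hP]
  gcongr
  exact control_le hR hP _ x u

theorem posSemidef_gapInv {lam : ℝ} {P : Matrix (Fin n) (Fin n) ℝ} (hD : (S.gap lam P).PosDef) :
    (S.gapInv lam P).PosSemidef := by
  have := hD.posSemidef.inv.mul_mul_conjTranspose_same S.Xi
  rwa [conjTranspose_eq_transpose_of_trivial] at this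

theorem posSemidef_maxStep {lam : ℝ} {f : QuadFun n} (hP : f.P.PosSemidef)
    (hD : (S.gap lam f.P).PosDef) : (S.maxStep lam f).P.PosSemidef := by
  have := (posSemidef_gapInv hD).conjTranspose_mul_mul_same f.P
  rw [conjTranspose_eq_transpose_of_trivial, hP.transpose_eq] at this
  exact hP.add this

/-- Completing the square in `d`: the penalized payoff has quadratic part `-(λ I - Ξᵀ P Ξ)`, so
positive definiteness of the gap makes `worst` the unique maximizer. -/
theorem maxStep_eval {lam : ℝ} {f : QuadFun n} (hP : f.P.PosSemidef)
    (hD : (S.gap lam f.P).PosDef) (y : Fin n → ℝ) (d : Fin k → ℝ) :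
    f.eval (y + S.Xi *ᵥ d) - lam * (d ⬝ᵥ d) = (S.maxStep lam f).eval y
      - (d - S.worst lam f y) ⬝ᵥ S.gap lam f.P *ᵥ (d - S.worst lam f y) := by
  obtain ⟨q, hq⟩ : ∃ q, q = f.P *ᵥ y + f.r := ⟨_, rfl⟩
  have hE := posSemidef_gapInv hD
  have hw : S.gap lam f.P *ᵥ S.worst lam f y = S.Xiᵀ *ᵥ q := by
    rw [worst, mulVec_mulVec, mul_nonsing_inv _ ((isUnit_iff_isUnit_det _).1 hD.isUnit),
      one_mulVec, hq]
  have hww : S.worst lam f y ⬝ᵥ S.gap lam f.P *ᵥ S.worst lam f y = q ⬝ᵥ S.gapInv lam f.P *ᵥ q := by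
    rw [hw, dotProduct_transpose_mulVec', worst, gapInv, ← hq, mulVec_mulVec, mulVec_mulVec]
  have h1 : d ⬝ᵥ S.gap lam f.P *ᵥ d
      = lam * (d ⬝ᵥ d) - (S.Xi *ᵥ d) ⬝ᵥ f.P *ᵥ (S.Xi *ᵥ d) := by
    rw [gap, sub_mulVec, smul_mulVec, one_mulVec, dotProduct_sub, dotProduct_smul, smul_eq_mul,
      ← mulVec_mulVec, ← mulVec_mulVec, dotProduct_transpose_mulVec', dotProduct_comm _ (S.Xi *ᵥ d)]
  have h2 : d ⬝ᵥ S.Xiᵀ *ᵥ q = (S.Xi *ᵥ d) ⬝ᵥ q := by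
    rw [dotProduct_transpose_mulVec', dotProduct_comm]
  have h3 : (S.maxStep lam f).eval y = f.eval y + q ⬝ᵥ S.gapInv lam f.P *ᵥ q := by
    have e1 : ∀ v, y ⬝ᵥ f.P *ᵥ v = (f.P *ᵥ y) ⬝ᵥ v := fun v => by
      rw [hP.dot_comm, dotProduct_comm]
    simp only [maxStep, QuadFun.eval, add_mulVec, dotProduct_add, add_dotProduct, hq,
      ← mulVec_mulVec, mulVec_add, e1]
    rw [hE.dot_comm f.r (f.P *ᵥ y), dotProduct_comm (f.P *ᵥ S.gapInv lam f.P *ᵥ f.r), e1]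
    ring
  rw [f.eval_add hP, ← hq, h3, ← hww]
  simp only [mulVec_sub, dotProduct_sub, sub_dotProduct, hD.posSemidef.dot_comm _ d]
  rw [h1, hw, h2]
  ring

theorem maxStep_eq {lam : ℝ} {f : QuadFun n} (hP : f.P.PosSemidef)
    (hD : (S.gap lam f.P).PosDef) (y : Fin n → ℝ) :
    (S.maxStep lam f).eval y = f.eval (y + S.Xi *ᵥ S.worst lam f y)
      - lam * (S.worst lam f y ⬝ᵥ S.worst lam f y) := by
  simp [maxStep_eval hP hD]

theorem le_maxStep {lam : ℝ} {f : QuadFun n} (hP : f.P.PosSemidef)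
    (hD : (S.gap lam f.P).PosDef) (y : Fin n → ℝ) (d : Fin k → ℝ) :
    f.eval (y + S.Xi *ᵥ d) - lam * (d ⬝ᵥ d) ≤ (S.maxStep lam f).eval y := by
  rw [maxStep_eval hP hD]
  linarith [hD.posSemidef.dot_nonneg (d - S.worst lam f y)]

/-- The minimizing control of the minimax problem. -/
def robustControl (S : LQSystem n m k N) (lam : ℝ) (f : QuadFun n) (x : Fin n → ℝ) : Fin m → ℝ :=
  S.lqgControl (S.maxStep lam f) x

theorem posSemidef_robustStep (hQ : S.Q.PosSemidef) (hR : S.R.PosDef) {lam : ℝ} {f : QuadFun n}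
    (hP : f.P.PosSemidef) (hD : (S.gap lam f.P).PosDef) : (S.robustStep lam f).P.PosSemidef :=
  posSemidef_lqgStep hQ hR (posSemidef_maxStep hP hD)

/-- The pure quadratic part of the dynamic programming step, upper inequality. -/
theorem exists_control_le_robustStep (hR : S.R.PosDef) {lam : ℝ} {f : QuadFun n}
    (hP : f.P.PosSemidef) (hD : (S.gap lam f.P).PosDef) (x : Fin n → ℝ) :
    ∃ u : Fin m → ℝ, ∀ d : Fin k → ℝ, S.stageCost x u +
      ((S.A *ᵥ x + S.B *ᵥ u + S.Xi *ᵥ d) ⬝ᵥ f.P *ᵥ (S.A *ᵥ x + S.B *ᵥ u + S.Xi *ᵥ d)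
        - lam * (d ⬝ᵥ d)) ≤ x ⬝ᵥ (S.robustStep lam f).P *ᵥ x := by
  have hM := posSemidef_maxStep hP hD
  refine ⟨S.optControl (S.maxStep lam f).P 0 x, fun d => ?_⟩
  have h1 := control_identity_opt hR hM 0 x
  have h2 := le_maxStep (f := ⟨f.P, 0, 0⟩) hP hD
    (S.A *ᵥ x + S.B *ᵥ S.optControl (S.maxStep lam f).P 0 x) d
  simp only [QuadFun.eval, maxStep, robustStep, lqgStep, stageCost, zero_dotProduct, mul_zero,
    add_zero, mulVec_zero, neg_zero, add_mulVec _ _ x, dotProduct_add x, dotProduct_zero]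
    at h1 h2 ⊢
  linarith

/-- The pure quadratic part of the dynamic programming step, lower inequality. -/
theorem exists_robustStep_le (hR : S.R.PosDef) {lam : ℝ} {f : QuadFun n}
    (hP : f.P.PosSemidef) (hD : (S.gap lam f.P).PosDef) (x : Fin n → ℝ) (u : Fin m → ℝ) :
    ∃ d : Fin k → ℝ, x ⬝ᵥ (S.robustStep lam f).P *ᵥ x ≤ S.stageCost x u +
      ((S.A *ᵥ x + S.B *ᵥ u + S.Xi *ᵥ d) ⬝ᵥ f.P *ᵥ (S.A *ᵥ x + S.B *ᵥ u + S.Xi *ᵥ d)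
        - lam * (d ⬝ᵥ d)) := by
  have hM := posSemidef_maxStep hP hD
  refine ⟨S.worst lam ⟨f.P, 0, 0⟩ (S.A *ᵥ x + S.B *ᵥ u), ?_⟩
  have h1 := control_le hR hM 0 x u
  have h2 := maxStep_eq (f := ⟨f.P, 0, 0⟩) hP hD (S.A *ᵥ x + S.B *ᵥ u)
  simp only [QuadFun.eval, maxStep, robustStep, lqgStep, stageCost, zero_dotProduct, mul_zero,
    add_zero, mulVec_zero, neg_zero, add_mulVec _ _ x, dotProduct_add x, dotProduct_zero]
    at h1 h2 ⊢
  linarith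

/-- Maximization followed by minimization collapses to a single Riccati step with `Φ`. This ties the
dynamic programming to `riccatiP`, in terms of which feasibility is stated. -/
theorem robustStep_P_eq (hR : S.R.PosDef) {lam : ℝ} (hlam : 0 < lam) {f : QuadFun n}
    (hP : f.P.PosSemidef) (hD : (S.gap lam f.P).PosDef) :
    (S.robustStep lam f).P = S.Q + S.Aᵀ * (1 + f.P * S.Phi lam)⁻¹ * f.P * S.A := by
  have hM := posSemidef_maxStep hP hD
  set P := f.P with hPdef
  set E := S.gapInv lam P with hE
  have hk : E - lam⁻¹ • (S.Xi * S.Xiᵀ) - lam⁻¹ • (S.Xi * S.Xiᵀ * P * E) = 0 := by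
    have h1 : S.gap lam P * (S.gap lam P)⁻¹ = 1 :=
      mul_nonsing_inv _ ((isUnit_iff_isUnit_det _).1 hD.isUnit)
    have h2 : lam • (S.gap lam P)⁻¹ = 1 + S.Xiᵀ * P * S.Xi * (S.gap lam P)⁻¹ := by
      nth_rewrite 1 [gap] at h1
      rw [Matrix.sub_mul, Matrix.smul_mul, Matrix.one_mul] at h1
      exact eq_add_of_sub_eq h1
    have h3 : lam • E = S.Xi * S.Xiᵀ + S.Xi * S.Xiᵀ * P * E := by
      rw [hE, gapInv, ← Matrix.smul_mul, ← Matrix.mul_smul, h2]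
      simp only [Matrix.mul_add, Matrix.add_mul, Matrix.mul_one, Matrix.mul_assoc]
    have h4 : E = lam⁻¹ • (S.Xi * S.Xiᵀ + S.Xi * S.Xiᵀ * P * E) := by
      rw [← h3, smul_smul, inv_mul_cancel₀ hlam.ne', one_smul]
    nth_rewrite 1 [h4]
    rw [smul_add]
    abel
  set W := lam⁻¹ • (S.Xi * S.Xiᵀ) with hW
  have hk' : E - W - W * P * E = 0 := by
    rw [← hk, hW, Matrix.smul_mul, Matrix.smul_mul]
  have hEW : E = W + W * P * E := by
    rw [sub_sub, sub_eq_zero] at hk'; exact hk'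
  have hinv : (1 - P * W) * (1 + P * E) = 1 := by
    have : (1 - P * W) * (1 + P * E) = 1 + P * (E - W - W * P * E) := by noncomm_ring
    rw [this, hk', Matrix.mul_zero, add_zero]
  have hinv' : (1 + P * E) * (1 - P * W) = 1 := mul_eq_one_comm.1 hinv
  have hmax : (S.maxStep lam f).P = (1 + P * E) * P := by
    simp only [maxStep]
    rw [Matrix.add_mul, Matrix.one_mul]
  -- The matrix to be inverted factors: the first factor undoes the maximization, since `1 - P W`
  -- and `1 + P E` are mutually inverse; the second is the LQG one.
  have hPhi : 1 + P * S.Phi lam = (1 - P * W) * (1 + (S.maxStep lam f).P * S.BRB) := by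
    have h1 : (1 - P * W) * (1 + (S.maxStep lam f).P * S.BRB)
        = 1 - P * W + ((1 - P * W) * (1 + P * E)) * P * S.BRB := by
      rw [hmax]; noncomm_ring
    rw [h1, hinv, Phi, one_div, ← hW]
    noncomm_ring
  have hG : (1 + P * S.Phi lam)⁻¹ = S.G (S.maxStep lam f).P * (1 + P * E) := by
    refine inv_eq_right_inv ?_
    rw [hPhi, Matrix.mul_assoc, ← Matrix.mul_assoc _ (S.G _), mul_G hR hM, Matrix.one_mul, hinv]
  rw [hG]
  simp only [robustStep, lqgStep]
  rw [hmax]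
  simp only [Matrix.mul_assoc]

/-- `l` satisfies the condition defining `λ̂₂`. -/
def Feasible (S : LQSystem n m k N) (l : ℝ) : Prop :=
  0 < l ∧ ∀ s, (S.gap l (S.riccatiP l s)).PosDef

theorem robustValue_P (hQ : S.Q.PosSemidef) (hQf : S.Qf.PosSemidef) (hR : S.R.PosDef) {l : ℝ}
    (hl : S.Feasible l) (s : ℕ) :
    (S.robustValue l s).P = S.riccatiP l s ∧ (S.riccatiP l s).PosSemidef := by
  induction s with
  | zero => exact ⟨rfl, hQf⟩
  | succ s ih =>
    have h1 : (S.robustValue l s).P.PosSemidef := ih.1 ▸ ih.2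
    have h2 : (S.gap l (S.robustValue l s).P).PosDef := ih.1 ▸ hl.2 s
    have h3 : (S.robustValue l (s + 1)).P = S.riccatiP l (s + 1) := by
      rw [robustValue, robustStep_P_eq hR hl.1 h1 h2, ih.1, riccatiP]
    exact ⟨h3, h3 ▸ posSemidef_robustStep hQ hR h1 h2⟩

theorem gap_posDef_of_le {lam l : ℝ} (hlam : l ≤ lam) {P P' : Matrix (Fin n) (Fin n) ℝ}
    (hP : P.PosSemidef) (h : ∀ x, x ⬝ᵥ P *ᵥ x ≤ x ⬝ᵥ P' *ᵥ x) (hD : (S.gap l P').PosDef) :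
    (S.gap lam P).PosDef := by
  have key : ∀ (c : ℝ) (M : Matrix (Fin n) (Fin n) ℝ) (x : Fin k → ℝ), x ⬝ᵥ S.gap c M *ᵥ x
      = c * (x ⬝ᵥ x) - (S.Xi *ᵥ x) ⬝ᵥ M *ᵥ (S.Xi *ᵥ x) := by
    intro c M x
    rw [gap, sub_mulVec, smul_mulVec, one_mulVec, dotProduct_sub, dotProduct_smul, smul_eq_mul,
      ← mulVec_mulVec, ← mulVec_mulVec, dotProduct_transpose_mulVec', dotProduct_comm _ (S.Xi *ᵥ x)]
  refine posDef_of_dot ?_ fun x hx => ?_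
  · simp [gap, transpose_mul, hP.transpose_eq, Matrix.mul_assoc]
  · have h1 := hD.dot_pos hx
    rw [key] at h1 ⊢
    have h2 := h (S.Xi *ᵥ x)
    have h3 : l * (x ⬝ᵥ x) ≤ lam * (x ⬝ᵥ x) :=
      mul_le_mul_of_nonneg_right hlam (by simpa using dotProduct_star_self_nonneg x)
    linarith

/-- The recursion stays well posed beyond a feasible value. -/
theorem robustValue_wellPosed (hQ : S.Q.PosSemidef) (hQf : S.Qf.PosSemidef) (hR : S.R.PosDef)
    {l lam : ℝ} (hl : S.Feasible l) (hlam : l ≤ lam) (s : ℕ) :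
    (S.robustValue lam s).P.PosSemidef ∧ (S.gap lam (S.robustValue lam s).P).PosDef ∧
      ∀ x, x ⬝ᵥ (S.robustValue lam s).P *ᵥ x ≤ x ⬝ᵥ S.riccatiP l s *ᵥ x := by
  suffices h : (S.robustValue lam s).P.PosSemidef ∧
      ∀ x, x ⬝ᵥ (S.robustValue lam s).P *ᵥ x ≤ x ⬝ᵥ S.riccatiP l s *ᵥ x from
    ⟨h.1, gap_posDef_of_le hlam h.1 h.2 (hl.2 s), h.2⟩
  induction s with
  | zero => exact ⟨hQf, fun x => le_rfl⟩
  | succ s ih =>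
    have hD := gap_posDef_of_le hlam ih.1 ih.2 (hl.2 s)
    refine ⟨posSemidef_robustStep hQ hR ih.1 hD, fun x => ?_⟩
    have hv := robustValue_P hQ hQf hR hl
    -- Compare strategies across the two games: the control optimal at `l` meets the deviation worst
    -- at `lam`, whose penalty is at least as heavy.
    obtain ⟨u, hu⟩ := exists_control_le_robustStep hR (f := S.robustValue l s) (lam := l)
      ((hv s).1 ▸ (hv s).2) ((hv s).1 ▸ hl.2 s) x
    obtain ⟨d, hd⟩ := exists_robustStep_le hR ih.1 hD x u
    have h1 := hu d
    rw [(hv s).1] at h1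
    have h2 := ih.2 (S.A *ᵥ x + S.B *ᵥ u + S.Xi *ᵥ d)
    have h3 : l * (d ⬝ᵥ d) ≤ lam * (d ⬝ᵥ d) :=
      mul_le_mul_of_nonneg_right hlam (by simpa using dotProduct_star_self_nonneg d)
    rw [← (hv (s + 1)).1]
    simp only [robustValue]
    linarith

theorem lqgValue_posSemidef (hQ : S.Q.PosSemidef) (hQf : S.Qf.PosSemidef) (hR : S.R.PosDef)
    (s : ℕ) : (S.lqgValue s).P.PosSemidef := by
  induction s with
  | zero => exact hQf
  | succ s ih => exact posSemidef_lqgStep hQ hR ih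

theorem lqgValue_nonneg (hN : 0 < N) (hQ : S.Q.PosSemidef) (hQf : S.Qf.PosSemidef)
    (hR : S.R.PosDef) (s : ℕ) (x : Fin n → ℝ) : 0 ≤ (S.lqgValue s).eval x := by
  induction s generalizing x with
  | zero => simpa [lqgValue, QuadFun.eval] using hQf.dot_nonneg x
  | succ s ih =>
    rw [lqgValue, ← lqgStep_eq hN hR (lqgValue_posSemidef hQ hQf hR s)]
    exact add_nonneg (S.stageCost_nonneg hQ hR _ _) (S.avg_nonneg fun i => ih _)

theorem maxStep_ge {lam : ℝ} {f : QuadFun n} (hP : f.P.PosSemidef)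
    (hD : (S.gap lam f.P).PosDef) (y : Fin n → ℝ) : f.eval y ≤ (S.maxStep lam f).eval y := by
  simpa using le_maxStep hP hD y 0

/-- Nonnegativity is what allows the values to be integrated through `ENNReal.ofReal` without loss.
-/
theorem robustValue_nonneg (hN : 0 < N) (hQ : S.Q.PosSemidef) (hQf : S.Qf.PosSemidef)
    (hR : S.R.PosDef) {l lam : ℝ} (hl : S.Feasible l) (hlam : l ≤ lam) (s : ℕ) (x : Fin n → ℝ) :
    0 ≤ (S.robustValue lam s).eval x := by
  induction s generalizing x with
  | zero => simpa [robustValue, QuadFun.eval] using hQf.dot_nonneg x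
  | succ s ih =>
    obtain ⟨hP, hD, -⟩ := robustValue_wellPosed hQ hQf hR hl hlam s
    rw [robustValue, robustStep, ← lqgStep_eq hN hR (posSemidef_maxStep hP hD)]
    exact add_nonneg (S.stageCost_nonneg hQ hR _ _)
      (S.avg_nonneg fun i => (ih _).trans (maxStep_ge hP hD _))

theorem stageCost_convex (hQ : S.Q.PosSemidef) (hR : S.R.PosDef) {α β : ℝ} (hα : 0 ≤ α)
    (hβ : 0 ≤ β) (hαβ : α + β = 1) (x y : Fin n → ℝ) (u v : Fin m → ℝ) :
    S.stageCost (α • x + β • y) (α • u + β • v)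
      ≤ α * S.stageCost x u + β * S.stageCost y v := by
  have h1 := hQ.dot_convex hα hβ hαβ x y
  have h2 := hR.posSemidef.dot_convex hα hβ hαβ u v
  simp only [stageCost]
  linarith

theorem stageCost_add_le (hQ : S.Q.PosSemidef) (hR : S.R.PosDef) {δ : ℝ} (hδ : 0 < δ)
    (x y : Fin n → ℝ) (u v : Fin m → ℝ) :
    S.stageCost (x + y) (u + v) ≤ (1 + δ) * S.stageCost x u + (1 + δ⁻¹) * S.stageCost y v := by
  have h1 := hQ.dot_add_le hδ x y
  have h2 := hR.posSemidef.dot_add_le hδ u v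
  simp only [stageCost]
  linarith

/-- The value function is jointly convex in the penalty parameter and the state. -/
theorem robustValue_convex (hN : 0 < N) (hQ : S.Q.PosSemidef) (hQf : S.Qf.PosSemidef)
    (hR : S.R.PosDef) {l l1 l2 : ℝ} (hl : S.Feasible l) (h1 : l ≤ l1) (h2 : l ≤ l2) {α β : ℝ}
    (hα : 0 ≤ α) (hβ : 0 ≤ β) (hαβ : α + β = 1) (s : ℕ) (x y : Fin n → ℝ) :
    (S.robustValue (α * l1 + β * l2) s).eval (α • x + β • y)
      ≤ α * (S.robustValue l1 s).eval x + β * (S.robustValue l2 s).eval y := by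
  induction s generalizing x y with
  | zero => simpa [robustValue, QuadFun.eval] using hQf.dot_convex hα hβ hαβ x y
  | succ s ih =>
    have hlam : l ≤ α * l1 + β * l2 := by
      calc l = α * l + β * l := by rw [← add_mul, hαβ, one_mul]
        _ ≤ _ := by gcongr
    obtain ⟨hP, hD, -⟩ := robustValue_wellPosed hQ hQf hR hl hlam s
    obtain ⟨hP1, hD1, -⟩ := robustValue_wellPosed hQ hQf hR hl h1 s
    obtain ⟨hP2, hD2, -⟩ := robustValue_wellPosed hQ hQf hR hl h2 s
    have e1 := lqgStep_eq hN hR (posSemidef_maxStep hP1 hD1) x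
    have e2 := lqgStep_eq hN hR (posSemidef_maxStep hP2 hD2) y
    simp only [robustValue, robustStep]
    set u := S.lqgControl (S.maxStep l1 (S.robustValue l1 s)) x
    set v := S.lqgControl (S.maxStep l2 (S.robustValue l2 s)) y
    refine (lqgStep_le hN hR (posSemidef_maxStep hP hD) _ (α • u + β • v)).trans ?_
    rw [← e1, ← e2]
    have hc := stageCost_convex hQ hR hα hβ hαβ x y u v
    have ha : S.avg (fun i => (S.maxStep (α * l1 + β * l2)
          (S.robustValue (α * l1 + β * l2) s)).eval
          (S.A *ᵥ (α • x + β • y) + S.B *ᵥ (α • u + β • v) + S.Xi *ᵥ S.sample i))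
        ≤ α * S.avg (fun i => (S.maxStep l1 (S.robustValue l1 s)).eval
            (S.A *ᵥ x + S.B *ᵥ u + S.Xi *ᵥ S.sample i))
          + β * S.avg (fun i => (S.maxStep l2 (S.robustValue l2 s)).eval
            (S.A *ᵥ y + S.B *ᵥ v + S.Xi *ᵥ S.sample i)) := by
      rw [← avg_mul, ← avg_mul, ← avg_add]
      refine S.avg_mono fun i => ?_
      rw [maxStep_eq hP hD]
      -- The same deviation `d` is used in both games on the right. The penalty is linear in its
      -- parameter, so it splits exactly.
      generalize S.worst (α * l1 + β * l2) (S.robustValue (α * l1 + β * l2) s) _ = d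
      set y1 := S.A *ᵥ x + S.B *ᵥ u + S.Xi *ᵥ S.sample i
      set y2 := S.A *ᵥ y + S.B *ᵥ v + S.Xi *ᵥ S.sample i
      have hy : S.A *ᵥ (α • x + β • y) + S.B *ᵥ (α • u + β • v) + S.Xi *ᵥ S.sample i + S.Xi *ᵥ d
          = α • (y1 + S.Xi *ᵥ d) + β • (y2 + S.Xi *ᵥ d) := by
        obtain rfl : β = 1 - α := by linarith
        simp only [y1, y2, mulVec_add, mulVec_smul]
        module
      rw [hy]
      have i0 := ih (y1 + S.Xi *ᵥ d) (y2 + S.Xi *ᵥ d)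
      have i1 := mul_le_mul_of_nonneg_left (le_maxStep hP1 hD1 y1 d) hα
      have i2 := mul_le_mul_of_nonneg_left (le_maxStep hP2 hD2 y2 d) hβ
      linarith
    linarith

/-- The value function of the minimax problem is dominated by the one of the LQG problem. -/
theorem robustValue_add_le (hN : 0 < N) (hQ : S.Q.PosSemidef) (hQf : S.Qf.PosSemidef)
    (hR : S.R.PosDef) {l lam δ : ℝ} (hl : S.Feasible l) (hδ : 0 < δ)
    (hlam : l * (1 + δ⁻¹) ≤ lam) (s : ℕ) (x e : Fin n → ℝ) :
    (S.robustValue lam s).eval (x + e) ≤ (1 + δ) * (S.lqgValue s).eval x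
      + (1 + δ⁻¹) * (e ⬝ᵥ S.riccatiP l s *ᵥ e) := by
  have hδ' := inv_pos.2 hδ
  have hll : l ≤ lam := by nlinarith [hl.1]
  -- Superposition: `x` follows the LQG problem under the sample disturbances with control `u`,
  -- while `e` follows the purely quadratic game at penalty `l`, driven by the deviations `d` alone,
  -- with control `v`.
  induction s generalizing x e with
  | zero => simpa [robustValue, lqgValue, riccatiP, QuadFun.eval] using hQf.dot_add_le hδ x e
  | succ s ih =>
    obtain ⟨hP, hD, -⟩ := robustValue_wellPosed hQ hQf hR hl hll s
    have hv := robustValue_P hQ hQf hR hl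
    have e1 := lqgStep_eq hN hR (lqgValue_posSemidef hQ hQf hR s) x
    obtain ⟨v, hv'⟩ := exists_control_le_robustStep hR (f := S.robustValue l s) (lam := l)
      ((hv s).1 ▸ (hv s).2) ((hv s).1 ▸ hl.2 s) e
    rw [(hv s).1] at hv'
    simp only [robustValue, robustStep, lqgValue]
    set u := S.lqgControl (S.lqgValue s) x
    refine (lqgStep_le hN hR (posSemidef_maxStep hP hD) _ (u + v)).trans ?_
    rw [← e1, ← (hv (s + 1)).1]
    have hc := stageCost_add_le hQ hR hδ x e u v
    have ha : S.avg (fun i => (S.maxStep lam (S.robustValue lam s)).eval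
          (S.A *ᵥ (x + e) + S.B *ᵥ (u + v) + S.Xi *ᵥ S.sample i))
        ≤ (1 + δ) * S.avg (fun i => (S.lqgValue s).eval
            (S.A *ᵥ x + S.B *ᵥ u + S.Xi *ᵥ S.sample i))
          + S.avg (fun _ => (1 + δ⁻¹) * (e ⬝ᵥ (S.robustValue l (s + 1)).P *ᵥ e
            - S.stageCost e v)) := by
      rw [← avg_mul, ← avg_add]
      refine S.avg_mono fun i => ?_
      rw [maxStep_eq hP hD]
      generalize S.worst lam (S.robustValue lam s) _ = d
      set y1 := S.A *ᵥ x + S.B *ᵥ u + S.Xi *ᵥ S.sample i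
      have hy : S.A *ᵥ (x + e) + S.B *ᵥ (u + v) + S.Xi *ᵥ S.sample i + S.Xi *ᵥ d
          = y1 + (S.A *ᵥ e + S.B *ᵥ v + S.Xi *ᵥ d) := by
        simp only [y1, mulVec_add]
        abel
      rw [hy]
      have i0 := ih y1 (S.A *ᵥ e + S.B *ᵥ v + S.Xi *ᵥ d)
      have i1 := mul_le_mul_of_nonneg_left (hv' d) (by positivity : 0 ≤ 1 + δ⁻¹)
      -- Young's inequality inflates the penalty of the `e` part to `l * (1 + δ⁻¹)`, which `lam` is
      -- assumed to cover.
      have i2 : l * (1 + δ⁻¹) * (d ⬝ᵥ d) ≤ lam * (d ⬝ᵥ d) :=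
        mul_le_mul_of_nonneg_right hlam (by simpa using dotProduct_star_self_nonneg d)
      simp only [robustValue]
      linarith
    rw [avg_const S hN] at ha
    linarith

theorem robustValue_le (hN : 0 < N) (hQ : S.Q.PosSemidef) (hQf : S.Qf.PosSemidef)
    (hR : S.R.PosDef) {l lam : ℝ} (hl : S.Feasible l) (hlam : l < lam) (s : ℕ) (x : Fin n → ℝ) :
    (S.robustValue lam s).eval x ≤ lam / (lam - l) * (S.lqgValue s).eval x := by
  have h0 := hl.1
  have hpos : 0 < lam - l := sub_pos.2 hlam
  -- This `δ` makes `l * (1 + δ⁻¹)` equal to `lam`, so it is the smallest admissible one.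
  have h := robustValue_add_le hN hQ hQf hR hl (δ := l / (lam - l)) (lam := lam) (by positivity)
    (by rw [inv_div]; field_simp; linarith) s x 0
  have e : 1 + l / (lam - l) = lam / (lam - l) := by field_simp; ring
  simpa [e] using h

end LQSystem

/-! ### Transport costs and empirical distributions. -/

section Wasserstein

variable {k : ℕ}

theorem le_wasserstein2_sq {μ ν : Measure (Fin k → ℝ)} {a : ℝ≥0∞}
    (h : ∀ η : Measure ((Fin k → ℝ) × (Fin k → ℝ)), η.map Prod.fst = μ → η.map Prod.snd = ν →
      a ≤ ∫⁻ p, ENNReal.ofReal ((p.1 - p.2) ⬝ᵥ (p.1 - p.2)) ∂η) :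
    a ≤ wasserstein2 μ ν ^ 2 := by
  have h1 : a ^ (1 / 2 : ℝ) ≤ wasserstein2 μ ν :=
    le_iInf fun η => le_iInf fun h1 => le_iInf fun h2 =>
      ENNReal.rpow_le_rpow (h η h1 h2) (by norm_num)
  calc a = (a ^ (1 / 2 : ℝ)) ^ 2 := by
        rw [← ENNReal.rpow_natCast, ← ENNReal.rpow_mul]; norm_num
    _ ≤ _ := by gcongr

theorem wasserstein2_sq_le {μ ν : Measure (Fin k → ℝ)}
    (η : Measure ((Fin k → ℝ) × (Fin k → ℝ))) (h1 : η.map Prod.fst = μ)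
    (h2 : η.map Prod.snd = ν) :
    wasserstein2 μ ν ^ 2 ≤ ∫⁻ p, ENNReal.ofReal ((p.1 - p.2) ⬝ᵥ (p.1 - p.2)) ∂η := by
  have h : wasserstein2 μ ν
      ≤ (∫⁻ p, ENNReal.ofReal ((p.1 - p.2) ⬝ᵥ (p.1 - p.2)) ∂η) ^ (1 / 2 : ℝ) :=
    (iInf_le _ η).trans ((iInf_le _ h1).trans (iInf_le _ h2))
  calc wasserstein2 μ ν ^ 2
      ≤ ((∫⁻ p, ENNReal.ofReal ((p.1 - p.2) ⬝ᵥ (p.1 - p.2)) ∂η) ^ (1 / 2 : ℝ)) ^ 2 := by gcongr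
    _ = _ := by rw [← ENNReal.rpow_natCast, ← ENNReal.rpow_mul]; norm_num

end Wasserstein

section Empirical

variable {α β : Type*} [MeasurableSpace α] [MeasurableSpace β] {N : ℕ}

/-- The empirical distribution of a finite family of points. -/
def empirical (f : Fin N → α) : Measure α := (N : ℝ≥0∞)⁻¹ • ∑ i, Measure.dirac (f i)

theorem lintegral_empirical (f : Fin N → α) {g : α → ℝ≥0∞} (hg : Measurable g) :
    ∫⁻ a, g a ∂(empirical f) = (N : ℝ≥0∞)⁻¹ * ∑ i, g (f i) := by
  rw [empirical, lintegral_smul_measure, lintegral_finsetSum_measure, smul_eq_mul]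
  simp_rw [lintegral_dirac' _ hg]

theorem empirical_apply (f : Fin N → α) {s : Set α} (hs : MeasurableSet s) :
    empirical f s = (N : ℝ≥0∞)⁻¹ * ∑ i, s.indicator 1 (f i) := by
  rw [← lintegral_indicator_one hs, lintegral_empirical f (measurable_one.indicator hs)]

theorem map_empirical (f : Fin N → α) {g : α → β} (hg : Measurable g) :
    (empirical f).map g = empirical (fun i => g (f i)) := by
  ext s hs
  rw [Measure.map_apply hg hs, empirical_apply _ hs, empirical_apply _ (hg hs)]
  rfl

theorem isProbabilityMeasure_empirical (hN : 0 < N) (f : Fin N → α) :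
    IsProbabilityMeasure (empirical f) := by
  refine ⟨?_⟩
  rw [empirical_apply _ MeasurableSet.univ]
  simp [ENNReal.inv_mul_cancel (a := (N : ℝ≥0∞)) (by exact_mod_cast hN.ne')]

/-- The kernel of empirical distributions of points depending measurably on the source. -/
def empiricalKernel (f : Fin N → α → β) (hf : ∀ i, Measurable (f i)) : Kernel α β where
  toFun a := empirical (fun i => f i a)
  measurable' := by
    refine Measure.measurable_of_measurable_coe _ fun s hs => ?_
    simp_rw [empirical_apply _ hs]
    exact (Finset.measurable_sum _ fun i _ =>
      (measurable_one.indicator hs).comp (hf i)).const_mul _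

end Empirical

/-! ### The value of the game with finite horizon. -/

namespace LQSystem

variable {n m k N : ℕ} {S : LQSystem n m k N}

theorem nu_eq : S.nu = empirical S.sample := rfl

theorem ofReal_avg (hN : 0 < N) {f : Fin N → ℝ} (hf : ∀ i, 0 ≤ f i) :
    ENNReal.ofReal (S.avg f) = (N : ℝ≥0∞)⁻¹ * ∑ i, ENNReal.ofReal (f i) := by
  rw [avg, ENNReal.ofReal_mul (by positivity), ENNReal.ofReal_inv_of_pos (by positivity),
    ENNReal.ofReal_natCast, ENNReal.ofReal_sum_of_nonneg fun i _ => hf i]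

theorem continuous_dot_self : Continuous fun d : Fin k → ℝ => d ⬝ᵥ d := by fun_prop

theorem dot_self_nonneg (d : Fin k → ℝ) : 0 ≤ d ⬝ᵥ d := by
  simpa using dotProduct_star_self_nonneg d

/-- Weak Kantorovich duality for an empirical distribution. -/
theorem lintegral_le_wasserstein2 (hN : 0 < N) {lam : ℝ} (hlam : 0 < lam)
    {f g : (Fin k → ℝ) → ℝ} (hfm : Measurable f) (hgm : Measurable g) (hg : ∀ w, 0 ≤ g w)
    (hfg : ∀ w v, f w ≤ lam * ((w - v) ⬝ᵥ (w - v)) + g v) (μ : Measure (Fin k → ℝ)) :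
    ∫⁻ w, ENNReal.ofReal (f w) ∂μ ≤ ENNReal.ofReal lam * wasserstein2 μ S.nu ^ 2
      + ENNReal.ofReal (S.avg fun i => g (S.sample i)) := by
  have hl0 : ENNReal.ofReal lam ≠ 0 := by simpa using hlam
  -- Solving for `W₂²`, with truncated subtraction, isolates a constant that can be tested against
  -- one coupling at a time.
  suffices h : (∫⁻ w, ENNReal.ofReal (f w) ∂μ
      - ENNReal.ofReal (S.avg fun i => g (S.sample i))) / ENNReal.ofReal lam
      ≤ wasserstein2 μ S.nu ^ 2 by
    rwa [ENNReal.div_le_iff hl0 ENNReal.ofReal_ne_top, tsub_le_iff_right, mul_comm] at h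
  refine le_wasserstein2_sq fun η h1 h2 => ?_
  rw [ENNReal.div_le_iff hl0 ENNReal.ofReal_ne_top, tsub_le_iff_right, mul_comm]
  rw [ofReal_avg hN fun i => hg _, ← lintegral_empirical S.sample (g := fun v => ENNReal.ofReal (g v)) hgm.ennreal_ofReal,
    ← nu_eq, ← h1, ← h2, lintegral_map hfm.ennreal_ofReal measurable_fst,
    lintegral_map hgm.ennreal_ofReal measurable_snd, ← lintegral_const_mul' _ _ ENNReal.ofReal_ne_top,
    ← lintegral_add_right (g := fun p : (Fin k → ℝ) × (Fin k → ℝ) => ENNReal.ofReal (g p.2)) _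
      (hgm.ennreal_ofReal.comp measurable_snd)]
  refine lintegral_mono fun p => ?_
  rw [← ENNReal.ofReal_mul hlam.le,
    ← ENNReal.ofReal_add (mul_nonneg hlam.le (dot_self_nonneg _)) (hg _)]
  exact ENNReal.ofReal_le_ofReal (hfg _ _)

theorem measurable_next {u : (Fin n → ℝ) → Fin m → ℝ} (hu : Measurable u) :
    Measurable fun p : (Fin n → ℝ) × (Fin k → ℝ) => S.A *ᵥ p.1 + S.B *ᵥ u p.1 + S.Xi *ᵥ p.2 := by
  have hB : Measurable fun v : Fin m → ℝ => S.B *ᵥ v :=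
    (by fun_prop : Continuous fun v : Fin m → ℝ => S.B *ᵥ v).measurable
  have h1 : Measurable fun p : (Fin n → ℝ) × (Fin k → ℝ) => S.A *ᵥ p.1 :=
    (by fun_prop : Continuous fun p : (Fin n → ℝ) × (Fin k → ℝ) => S.A *ᵥ p.1).measurable
  have h2 : Measurable fun p : (Fin n → ℝ) × (Fin k → ℝ) => S.Xi *ᵥ p.2 :=
    (by fun_prop : Continuous fun p : (Fin n → ℝ) × (Fin k → ℝ) => S.Xi *ᵥ p.2).measurable
  exact (h1.add (hB.comp (hu.comp measurable_fst))).add h2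

theorem isProbabilityMeasure_stateLaw (π : ControlPolicy n m) (γ : OpponentPolicy n k)
    (x : Fin n → ℝ) (t : ℕ) : IsProbabilityMeasure (S.stateLaw π γ x t) := by
  induction t with
  | zero => rw [stateLaw]; infer_instance
  | succ t ih =>
    have := γ.2 t
    rw [stateLaw]
    exact Measure.isProbabilityMeasure_map (measurable_next (π.2 t)).aemeasurable

theorem lintegral_stateLaw_succ (π : ControlPolicy n m) (γ : OpponentPolicy n k)
    (x : Fin n → ℝ) (t : ℕ) {g : (Fin n → ℝ) → ℝ≥0∞} (hg : Measurable g) :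
    ∫⁻ y, g y ∂(S.stateLaw π γ x (t + 1))
      = ∫⁻ y, ∫⁻ w, g (S.A *ᵥ y + S.B *ᵥ π.1 t y + S.Xi *ᵥ w) ∂(γ.1 t y)
        ∂(S.stateLaw π γ x t) := by
  have := γ.2 t
  have := S.isProbabilityMeasure_stateLaw π γ x t
  have hm := S.measurable_next (π.2 t)
  refine (lintegral_map hg hm).trans ?_
  exact Measure.lintegral_compProd (hg.comp hm)

theorem measurable_stageCost (π : ControlPolicy n m) (t : ℕ) :
    Measurable fun y => ENNReal.ofReal (S.stageCost y (π.1 t y)) := by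
  have hc : Continuous fun p : (Fin n → ℝ) × (Fin m → ℝ) => S.stageCost p.1 p.2 := by
    unfold stageCost; fun_prop
  exact (hc.measurable.comp (measurable_id.prodMk (π.2 t))).ennreal_ofReal

theorem measurable_eval (f : QuadFun n) : Measurable fun y => ENNReal.ofReal (f.eval y) :=
  f.continuous_eval.measurable.ennreal_ofReal

theorem continuous_lqgControl (f : QuadFun n) : Continuous (S.lqgControl f) := by
  unfold lqgControl optControl
  fun_prop

theorem continuous_worst (lam : ℝ) (f : QuadFun n) : Continuous (S.worst lam f) := by
  unfold worst
  fun_prop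

/-- Weak duality applied to the next value and its `maxStep`: the inequality `le_maxStep`, with `d =
w - v`, is exactly the dual constraint. -/
theorem robustStep_ge_wasserstein2 (hN : 0 < N) (hQ : S.Q.PosSemidef) (hR : S.R.PosDef)
    {lam : ℝ} (hlam : 0 < lam) {f : QuadFun n} (hf : ∀ x, 0 ≤ f.eval x) (hP : f.P.PosSemidef)
    (hD : (S.gap lam f.P).PosDef) (y : Fin n → ℝ) (μ : Measure (Fin k → ℝ)) :
    ENNReal.ofReal (S.stageCost y (S.robustControl lam f y))
      + ∫⁻ w, ENNReal.ofReal (f.eval (S.A *ᵥ y + S.B *ᵥ S.robustControl lam f y + S.Xi *ᵥ w)) ∂μ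
      ≤ ENNReal.ofReal ((S.robustStep lam f).eval y)
        + ENNReal.ofReal lam * wasserstein2 μ S.nu ^ 2 := by
  have e := lqgStep_eq hN hR (posSemidef_maxStep hP hD) y
  rw [← robustStep, ← robustControl] at e
  set c := S.A *ᵥ y + S.B *ᵥ S.robustControl lam f y
  have hc : ∀ g : QuadFun n, Measurable fun w : Fin k → ℝ => g.eval (c + S.Xi *ᵥ w) := fun g =>
    (g.continuous_eval.comp (by fun_prop : Continuous fun w : Fin k → ℝ => c + S.Xi *ᵥ w)).measurable
  have hg : ∀ w : Fin k → ℝ, 0 ≤ (S.maxStep lam f).eval (c + S.Xi *ᵥ w) := fun w =>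
    (hf _).trans (maxStep_ge hP hD _)
  have h := lintegral_le_wasserstein2 (S := S) hN hlam (hc f) (hc (S.maxStep lam f)) hg
    (fun w v => by
      have := le_maxStep hP hD (c + S.Xi *ᵥ v) (w - v)
      rw [mulVec_sub, add_add_sub_cancel] at this
      linarith) μ
  rw [← e, ENNReal.ofReal_add (S.stageCost_nonneg hQ hR _ _) (S.avg_nonneg fun i => hg _),
    add_assoc, add_comm (ENNReal.ofReal (S.avg _))]
  gcongr

/-- The optimal policy of the minimax problem with horizon `T`. -/
def robustPolicy (S : LQSystem n m k N) (lam : ℝ) (T : ℕ) : ControlPolicy n m :=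
  ⟨fun t => S.robustControl lam (S.robustValue lam (T - (t + 1))),
    fun _ => (S.continuous_lqgControl _).measurable⟩

theorem quadraticCost_eq (T : ℕ) (x : Fin n → ℝ) (π : ControlPolicy n m)
    (γ : OpponentPolicy n k) :
    S.quadraticCost T x π γ = (∫⁻ y, ENNReal.ofReal ((QuadFun.mk S.Qf 0 0).eval y)
      ∂(S.stateLaw π γ x T)) + ∑ t ∈ Finset.range T,
      ∫⁻ y, ENNReal.ofReal (S.stageCost y (π.1 t y)) ∂(S.stateLaw π γ x t) := by
  simp [quadraticCost, QuadFun.eval, stageCost]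

/-- Telescoping: cost so far plus expected value of the stages to go never exceeds the initial value
plus the penalty so far. Keeping the penalty on the right avoids subtraction and covers infinite
penalties. -/
theorem quadraticCost_robustPolicy_le (hN : 0 < N) (hQ : S.Q.PosSemidef) (hQf : S.Qf.PosSemidef)
    (hR : S.R.PosDef) {l lam : ℝ} (hl : S.Feasible l) (hlam : l ≤ lam) (T : ℕ) (x : Fin n → ℝ)
    (γ : OpponentPolicy n k) :
    S.quadraticCost T x (S.robustPolicy lam T) γ ≤ ENNReal.ofReal ((S.robustValue lam T).eval x)
      + ENNReal.ofReal lam * S.wassersteinPenalty T x (S.robustPolicy lam T) γ := by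
  set π := S.robustPolicy lam T with hπ
  have h : ∀ t ≤ T, (∑ τ ∈ Finset.range t,
        ∫⁻ y, ENNReal.ofReal (S.stageCost y (π.1 τ y)) ∂(S.stateLaw π γ x τ))
      + ∫⁻ y, ENNReal.ofReal ((S.robustValue lam (T - t)).eval y) ∂(S.stateLaw π γ x t)
      ≤ ENNReal.ofReal ((S.robustValue lam T).eval x) + ENNReal.ofReal lam *
        ∑ τ ∈ Finset.range t, ∫⁻ y, wasserstein2 (γ.1 τ y) S.nu ^ 2 ∂(S.stateLaw π γ x τ) := by
    intro t
    induction t with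
    | zero =>
      intro _
      simp [stateLaw, lintegral_dirac' _ (measurable_eval _)]
    | succ t ih =>
      intro ht
      refine le_trans ?_ (le_trans (add_le_add_left (ih (by omega)) (ENNReal.ofReal lam *
        ∫⁻ y, wasserstein2 (γ.1 t y) S.nu ^ 2 ∂(S.stateLaw π γ x t))) ?_)
      · rw [Finset.sum_range_succ, add_assoc, add_assoc]
        refine add_le_add_right ?_ _
        rw [lintegral_stateLaw_succ π γ x t (measurable_eval _),
          ← lintegral_add_left (measurable_stageCost π t),
          ← lintegral_const_mul' _ _ ENNReal.ofReal_ne_top, ← lintegral_add_left (measurable_eval _)]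
        refine lintegral_mono fun y => ?_
        obtain ⟨s, hs⟩ : ∃ s, T - t = s + 1 := ⟨T - (t + 1), by omega⟩
        have hs' : T - (t + 1) = s := by omega
        obtain ⟨hP, hD, -⟩ := robustValue_wellPosed hQ hQf hR hl hlam s
        rw [hs, hs', robustValue]
        have := robustStep_ge_wasserstein2 hN hQ hR (hl.1.trans_le hlam)
          (robustValue_nonneg hN hQ hQf hR hl hlam s) hP hD y (γ.1 t y)
        have hu : π.1 t y = S.robustControl lam (S.robustValue lam s) y := by
          subst hs'
          rfl
        rw [hu]
        exact this
      · rw [Finset.sum_range_succ, mul_add, add_assoc]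
  have h1 := h T le_rfl
  rw [Nat.sub_self, robustValue] at h1
  rw [quadraticCost_eq, add_comm]
  exact h1

theorem penalizedCost_robustPolicy_le (hN : 0 < N) (hQ : S.Q.PosSemidef)
    (hQf : S.Qf.PosSemidef) (hR : S.R.PosDef) {l lam : ℝ} (hl : S.Feasible l) (hlam : l ≤ lam)
    (T : ℕ) (x : Fin n → ℝ) (γ : OpponentPolicy n k) :
    S.penalizedCost lam T x (S.robustPolicy lam T) γ
      ≤ (((S.robustValue lam T).eval x / T : ℝ) : EReal) := by
  rw [penalizedCost, EReal.coe_div, EReal.coe_natCast]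
  refine EReal.div_le_div_right_of_nonneg (by positivity) (EReal.sub_le_of_le_add ?_)
  rw [← max_eq_left (robustValue_nonneg hN hQ hQf hR hl hlam T x), ← EReal.coe_ennreal_ofReal,
    ← EReal.coe_ennreal_add]
  exact EReal.coe_ennreal_le_coe_ennreal_iff.2
    (quadraticCost_robustPolicy_le hN hQ hQf hR hl hlam T x γ)

theorem lintegral_empirical_eval (hN : 0 < N) {f : QuadFun n} (hf : ∀ x, 0 ≤ f.eval x)
    (c : Fin n → ℝ) (w : Fin N → Fin k → ℝ) :
    ∫⁻ v, ENNReal.ofReal (f.eval (c + S.Xi *ᵥ v)) ∂(empirical w)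
      = ENNReal.ofReal (S.avg fun i => f.eval (c + S.Xi *ᵥ w i)) := by
  have h : Continuous fun v : Fin k → ℝ => f.eval (c + S.Xi *ᵥ v) :=
    f.continuous_eval.comp (by fun_prop)
  rw [lintegral_empirical w h.measurable.ennreal_ofReal, ofReal_avg hN fun i => hf _]

/-- An opponent who shifts the samples secures the value of a dynamic programming inequality. -/
theorem exists_opponent (hN : 0 < N) (hQ : S.Q.PosSemidef) (hR : S.R.PosDef) {lam : ℝ}
    (hlam : 0 ≤ lam) (T : ℕ) (V : ℕ → QuadFun n) (hV0 : V 0 = ⟨S.Qf, 0, 0⟩)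
    (hV : ∀ s x, 0 ≤ (V s).eval x) (d : ℕ → Fin N → (Fin n → ℝ) → (Fin m → ℝ) → Fin k → ℝ)
    (hd : ∀ s i, Continuous fun p : (Fin n → ℝ) × (Fin m → ℝ) => d s i p.1 p.2)
    (hstep : ∀ s y u, (V (s + 1)).eval y + lam * S.avg (fun i => d s i y u ⬝ᵥ d s i y u)
      ≤ S.stageCost y u
        + S.avg fun i => (V s).eval (S.A *ᵥ y + S.B *ᵥ u + S.Xi *ᵥ (S.sample i + d s i y u)))
    (x : Fin n → ℝ) (π : ControlPolicy n m) :
    ∃ γ : OpponentPolicy n k, (((V T).eval x / T : ℝ) : EReal) ≤ S.penalizedCost lam T x π γ := by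
  have hdm : ∀ t s i, Measurable fun y => d s i y (π.1 t y) := fun t s i =>
    (hd s i).measurable.comp (measurable_id.prodMk (π.2 t))
  -- The opponent answers a given `π`, so the displacement may depend on the control as well as on
  -- the state. After stage `t` there remain `T - (t + 1)` stages.
  let γ : OpponentPolicy n k := ⟨fun t => empiricalKernel
    (fun i y => S.sample i + d (T - (t + 1)) i y (π.1 t y))
    (fun i => (hdm t _ i).const_add _), fun t => ⟨fun y => isProbabilityMeasure_empirical hN _⟩⟩
  have hγ : ∀ t y, γ.1 t y = empirical fun i => S.sample i + d (T - (t + 1)) i y (π.1 t y) :=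
    fun t y => rfl
  let pen : ℕ → (Fin n → ℝ) → ℝ := fun t y => S.avg fun i =>
    d (T - (t + 1)) i y (π.1 t y) ⬝ᵥ d (T - (t + 1)) i y (π.1 t y)
  have hpen0 : ∀ t y, 0 ≤ pen t y := fun t y => S.avg_nonneg fun i => dot_self_nonneg _
  have hpenm : ∀ t, Measurable fun y => ENNReal.ofReal (pen t y) := fun t =>
    ((Finset.measurable_sum _ fun i _ =>
      continuous_dot_self.measurable.comp (hdm t _ i)).const_mul _).ennreal_ofReal
  -- every finite measurable function has a finite integral under the state laws
  have htame : ∀ t (g : (Fin n → ℝ) → ℝ≥0∞), Measurable g → (∀ y, g y < ⊤) →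
      ∫⁻ y, g y ∂(S.stateLaw π γ x t) < ⊤ := by
    intro t
    induction t with
    | zero =>
      intro g hg hgf
      rw [stateLaw, lintegral_dirac' _ hg]
      exact hgf x
    | succ t ih =>
      intro g hg hgf
      rw [lintegral_stateLaw_succ π γ x t hg]
      have hm := S.measurable_next (π.2 t)
      have e : ∀ y, ∫⁻ w, g (S.A *ᵥ y + S.B *ᵥ π.1 t y + S.Xi *ᵥ w) ∂(γ.1 t y)
          = (N : ℝ≥0∞)⁻¹ * ∑ i, g (S.A *ᵥ y + S.B *ᵥ π.1 t y
            + S.Xi *ᵥ (S.sample i + d (T - (t + 1)) i y (π.1 t y))) := fun y => by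
        rw [hγ]
        exact lintegral_empirical _ ((hg.comp hm).comp measurable_prodMk_left)
      simp_rw [e]
      refine ih _ ((Finset.measurable_sum _ fun i _ => (hg.comp hm).comp
        (measurable_id.prodMk ((hdm t _ i).const_add _))).const_mul _) fun y => ?_
      exact ENNReal.mul_lt_top (by simp [hN]) (ENNReal.sum_lt_top.2 fun i _ => hgf _)
  have hW : ∀ t y, wasserstein2 (γ.1 t y) S.nu ^ 2 ≤ ENNReal.ofReal (pen t y) := by
    intro t y
    -- Couple each displaced sample with the sample itself.
    refine (wasserstein2_sq_le (empirical fun i =>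
      (S.sample i + d (T - (t + 1)) i y (π.1 t y), S.sample i))
      (by rw [map_empirical _ measurable_fst, hγ]) (by rw [map_empirical _ measurable_snd, nu_eq])).trans_eq ?_
    rw [lintegral_empirical, ofReal_avg hN fun i => dot_self_nonneg _]
    · simp
    · exact (by fun_prop : Continuous fun p : (Fin k → ℝ) × (Fin k → ℝ) =>
        (p.1 - p.2) ⬝ᵥ (p.1 - p.2)).measurable.ennreal_ofReal
  have hsum : ∀ t ≤ T, ENNReal.ofReal ((V T).eval x) + ENNReal.ofReal lam *
        ∑ τ ∈ Finset.range t, ∫⁻ y, ENNReal.ofReal (pen τ y) ∂(S.stateLaw π γ x τ)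
      ≤ (∑ τ ∈ Finset.range t,
        ∫⁻ y, ENNReal.ofReal (S.stageCost y (π.1 τ y)) ∂(S.stateLaw π γ x τ))
      + ∫⁻ y, ENNReal.ofReal ((V (T - t)).eval y) ∂(S.stateLaw π γ x t) := by
    intro t
    induction t with
    | zero =>
      intro _
      simp [stateLaw, lintegral_dirac' _ (measurable_eval _)]
    | succ t ih =>
      intro ht
      refine le_trans ?_ (le_trans (add_le_add_left (ih (by omega)) (ENNReal.ofReal lam *
        ∫⁻ y, ENNReal.ofReal (pen t y) ∂(S.stateLaw π γ x t))) ?_)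
      · rw [Finset.sum_range_succ, mul_add, add_assoc]
      · rw [Finset.sum_range_succ, add_assoc, add_assoc]
        refine add_le_add_right ?_ _
        rw [lintegral_stateLaw_succ π γ x t (measurable_eval _),
          ← lintegral_add_left (measurable_stageCost π t),
          ← lintegral_const_mul' _ _ ENNReal.ofReal_ne_top, ← lintegral_add_left (measurable_eval _)]
        refine lintegral_mono fun y => ?_
        obtain ⟨s, hs⟩ : ∃ s, T - t = s + 1 := ⟨T - (t + 1), by omega⟩
        have hs' : T - (t + 1) = s := by omega
        rw [hγ, lintegral_empirical_eval hN (hV _), ← ENNReal.ofReal_mul hlam, ← ENNReal.ofReal_add (hV _ _) (mul_nonneg hlam (hpen0 _ _)),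
          ← ENNReal.ofReal_add (S.stageCost_nonneg hQ hR _ _) (S.avg_nonneg fun i => hV _ _)]
        refine ENNReal.ofReal_le_ofReal ?_
        simp only [pen, hs, hs']
        exact hstep s y (π.1 t y)
  refine ⟨γ, ?_⟩
  rw [penalizedCost, EReal.coe_div, EReal.coe_natCast]
  refine EReal.div_le_div_right_of_nonneg (by positivity) ?_
  have hP : S.wassersteinPenalty T x π γ
      ≤ ∑ τ ∈ Finset.range T, ∫⁻ y, ENNReal.ofReal (pen τ y) ∂(S.stateLaw π γ x τ) :=
    Finset.sum_le_sum fun τ _ => lintegral_mono fun y => hW τ y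
  -- Finiteness excludes the value `-∞` and permits moving the penalty across the inequality in
  -- `EReal`.
  have hfin : S.wassersteinPenalty T x π γ < ⊤ := hP.trans_lt
    (ENNReal.sum_lt_top.2 fun τ _ => htame τ _ (hpenm τ) fun y => ENNReal.ofReal_lt_top)
  have hfin' : ENNReal.ofReal lam * S.wassersteinPenalty T x π γ ≠ ⊤ :=
    ENNReal.mul_ne_top ENNReal.ofReal_ne_top hfin.ne
  rw [EReal.le_sub_iff_add_le (Or.inl (EReal.coe_ennreal_ne_bot _))
    (Or.inl fun h => hfin' (EReal.coe_ennreal_eq_top_iff.1 h)), ← max_eq_left (hV T x), ← EReal.coe_ennreal_ofReal,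
    ← EReal.coe_ennreal_add]
  refine EReal.coe_ennreal_le_coe_ennreal_iff.2 ?_
  have h1 := hsum T le_rfl
  rw [Nat.sub_self, hV0] at h1
  rw [quadraticCost_eq, add_comm (∫⁻ y, _ ∂_)]
  refine le_trans ?_ h1
  gcongr

/-- `robustPolicy` caps every opponent; conversely, against any control policy, displacing each
sample by its `worst` deviation makes the maximization in the stage tight. -/
theorem minimaxValue_eq (hN : 0 < N) (hQ : S.Q.PosSemidef) (hQf : S.Qf.PosSemidef)
    (hR : S.R.PosDef) {l lam : ℝ} (hl : S.Feasible l) (hlam : l ≤ lam) (T : ℕ) (x : Fin n → ℝ) :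
    S.minimaxValue lam T x = (((S.robustValue lam T).eval x / T : ℝ) : EReal) := by
  refine le_antisymm ((iInf_le _ (S.robustPolicy lam T)).trans (iSup_le fun γ =>
    penalizedCost_robustPolicy_le hN hQ hQf hR hl hlam T x γ)) (le_iInf fun π => ?_)
  obtain ⟨γ, hγ⟩ := exists_opponent hN hQ hR (hl.1.le.trans hlam) T (S.robustValue lam) rfl
    (robustValue_nonneg hN hQ hQf hR hl hlam)
    (fun s i y u => S.worst lam (S.robustValue lam s) (S.A *ᵥ y + S.B *ᵥ u + S.Xi *ᵥ S.sample i))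
    (fun s i => (S.continuous_worst _ _).comp (by fun_prop))
    (fun s y u => by
      obtain ⟨hP, hD, -⟩ := robustValue_wellPosed hQ hQf hR hl hlam s
      have h := lqgStep_le hN hR (posSemidef_maxStep hP hD) y u
      simp only [maxStep_eq hP hD, sub_eq_add_neg, avg_add, ← mul_neg] at h
      rw [avg_mul] at h
      have e : ∀ g : Fin N → ℝ, S.avg (fun i => -g i) = -S.avg g := fun g => by
        simpa using S.avg_mul (-1) g
      rw [e] at h
      simp only [mulVec_add, ← add_assoc]
      rw [robustValue, robustStep]
      linarith) x π
  exact hγ.trans (le_iSup (fun γ => S.penalizedCost lam T x π γ) γ)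

/-- With zero displacement the opponent plays `ν`, pays no penalty, and leaves the controller an LQG
problem. -/
theorem lqgValue_le_minimaxValue (hN : 0 < N) (hQ : S.Q.PosSemidef) (hQf : S.Qf.PosSemidef)
    (hR : S.R.PosDef) {lam : ℝ} (hlam : 0 ≤ lam) (T : ℕ) (x : Fin n → ℝ) :
    (((S.lqgValue T).eval x / T : ℝ) : EReal) ≤ S.minimaxValue lam T x := by
  refine le_iInf fun π => ?_
  obtain ⟨γ, hγ⟩ := exists_opponent hN hQ hR hlam T S.lqgValue rfl
    (lqgValue_nonneg hN hQ hQf hR) (fun s i y u => 0) (fun s i => continuous_const)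
    (fun s y u => by
      have h := lqgStep_le hN hR (lqgValue_posSemidef hQ hQf hR s) y u
      simpa [avg_const S hN, lqgValue] using h) x π
  exact hγ.trans (le_iSup (fun γ => S.penalizedCost lam T x π γ) γ)

end LQSystem

/-! ### Limits of matrices and powers of stable matrices. -/

namespace Matrix

variable {a : ℕ}

theorem apply_eq_dot {M : Matrix (Fin a) (Fin a) ℝ} (hM : Mᵀ = M) (i j : Fin a) :
    M i j = ((Pi.single i 1 + Pi.single j 1) ⬝ᵥ M *ᵥ (Pi.single i 1 + Pi.single j 1)
      - Pi.single i 1 ⬝ᵥ M *ᵥ Pi.single i 1 - Pi.single j 1 ⬝ᵥ M *ᵥ Pi.single j 1) / 2 := by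
  have h : M j i = M i j := congrFun (congrFun hM i) j
  simp only [mulVec_add, dotProduct_add, add_dotProduct, mulVec_single_one, single_one_dotProduct,
    col_apply, h]
  ring

/-- Symmetric matrices converge if their quadratic forms converge pointwise. -/
theorem exists_tendsto_of_dot {M : ℕ → Matrix (Fin a) (Fin a) ℝ} (hM : ∀ s, (M s)ᵀ = M s)
    (h : ∀ x : Fin a → ℝ, ∃ c, Tendsto (fun s => x ⬝ᵥ M s *ᵥ x) atTop (𝓝 c)) :
    ∃ L, Tendsto M atTop (𝓝 L) := by
  choose c hc using h
  refine ⟨fun i j => (c (Pi.single i 1 + Pi.single j 1) - c (Pi.single i 1)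
    - c (Pi.single j 1)) / 2, tendsto_pi_nhds.2 fun i => tendsto_pi_nhds.2 fun j => ?_⟩
  simp_rw [fun s => apply_eq_dot (hM s) i j]
  exact (((hc _).sub (hc _)).sub (hc _)).div_const 2

theorem tendsto_of_dot {M : ℕ → Matrix (Fin a) (Fin a) ℝ} {L : Matrix (Fin a) (Fin a) ℝ}
    (hM : ∀ s, (M s)ᵀ = M s) (hL : Lᵀ = L)
    (h : ∀ x : Fin a → ℝ, Tendsto (fun s => x ⬝ᵥ M s *ᵥ x) atTop (𝓝 (x ⬝ᵥ L *ᵥ x))) :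
    Tendsto M atTop (𝓝 L) := by
  refine tendsto_pi_nhds.2 fun i => tendsto_pi_nhds.2 fun j => ?_
  simp_rw [fun s => apply_eq_dot (hM s) i j]
  rw [apply_eq_dot hL i j]
  exact (((h _).sub (h _)).sub (h _)).div_const 2

theorem tendsto_dot {M : ℕ → Matrix (Fin a) (Fin a) ℝ} {L : Matrix (Fin a) (Fin a) ℝ}
    (h : Tendsto M atTop (𝓝 L)) (x : Fin a → ℝ) :
    Tendsto (fun s => x ⬝ᵥ M s *ᵥ x) atTop (𝓝 (x ⬝ᵥ L *ᵥ x)) :=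
  ((by fun_prop : Continuous fun P : Matrix (Fin a) (Fin a) ℝ => x ⬝ᵥ P *ᵥ x).tendsto L).comp h

theorem PosSemidef.of_tendsto {M : ℕ → Matrix (Fin a) (Fin a) ℝ} {L : Matrix (Fin a) (Fin a) ℝ}
    (h : Tendsto M atTop (𝓝 L)) (hM : ∀ s, (M s).PosSemidef) : L.PosSemidef := by
  refine posSemidef_of_dot ?_ fun x =>
    ge_of_tendsto (tendsto_dot h x) (.of_forall fun s => (hM s).dot_nonneg x)
  have h1 : Tendsto (fun s => (M s)ᵀ) atTop (𝓝 Lᵀ) :=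
    ((by fun_prop : Continuous fun P : Matrix (Fin a) (Fin a) ℝ => Pᵀ).tendsto L).comp h
  simp_rw [fun s => (hM s).transpose_eq] at h1
  exact tendsto_nhds_unique h1 h

theorem tendsto_inv {M : ℕ → Matrix (Fin a) (Fin a) ℝ} {L : Matrix (Fin a) (Fin a) ℝ}
    (h : Tendsto M atTop (𝓝 L)) (hL : IsUnit L) : Tendsto (fun s => (M s)⁻¹) atTop (𝓝 L⁻¹) := by
  have hd : L.det ≠ 0 := ((isUnit_iff_isUnit_det _).1 hL).ne_zero
  simp_rw [inv_def, Ring.inverse_eq_inv']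
  exact ((((continuous_id.matrix_det).tendsto L).comp h).inv₀ hd).smul
    (((continuous_id.matrix_adjugate).tendsto L).comp h)

theorem PosSemidef.dot_sq_le {W : Matrix (Fin a) (Fin a) ℝ} (hW : W.PosSemidef)
    (x y : Fin a → ℝ) : (x ⬝ᵥ W *ᵥ y) ^ 2 ≤ (x ⬝ᵥ W *ᵥ x) * (y ⬝ᵥ W *ᵥ y) := by
  have h := discrim_le_zero (a := x ⬝ᵥ W *ᵥ x) (b := 2 * (x ⬝ᵥ W *ᵥ y)) (c := y ⬝ᵥ W *ᵥ y)
    fun t => by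
      have := hW.dot_nonneg (t • x + y)
      simp only [mulVec_add, mulVec_smul, dotProduct_add, add_dotProduct, dotProduct_smul,
        smul_dotProduct, smul_eq_mul, hW.dot_comm y x] at this
      linarith
  rw [discrim] at h
  linarith

theorem PosDef.tendsto_zero {W : Matrix (Fin a) (Fin a) ℝ} (hW : W.PosDef) {x : ℕ → Fin a → ℝ}
    (h : Tendsto (fun s => x s ⬝ᵥ W *ᵥ x s) atTop (𝓝 0)) : Tendsto x atTop (𝓝 0) := by
  refine tendsto_pi_nhds.2 fun i => ?_
  -- Each coordinate is a `W`-inner product with `z`, so Cauchy–Schwarz bounds it without any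
  -- eigenvalue estimate.
  set z := W⁻¹ *ᵥ Pi.single i 1
  have hz : ∀ v, v i = z ⬝ᵥ W *ᵥ v := fun v => by
    rw [hW.posSemidef.dot_comm, mulVec_mulVec,
      mul_nonsing_inv _ ((isUnit_iff_isUnit_det _).1 hW.isUnit), one_mulVec, dotProduct_single_one]
  have h1 : Tendsto (fun s => x s i ^ 2) atTop (𝓝 0) := by
    refine squeeze_zero (fun s => sq_nonneg _) (fun s => ?_)
      (by simpa using h.const_mul (z ⬝ᵥ W *ᵥ z))
    rw [hz (x s)]
    exact hW.posSemidef.dot_sq_le _ _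
  have h2 := h1.sqrt
  simp_rw [Real.sqrt_sq_eq_abs, Real.sqrt_zero] at h2
  exact (tendsto_zero_iff_abs_tendsto_zero _).2 h2

theorem tendsto_pow_zero_of_mulVec {M : Matrix (Fin a) (Fin a) ℝ}
    (h : ∀ x : Fin a → ℝ, Tendsto (fun s => M ^ s *ᵥ x) atTop (𝓝 0)) :
    Tendsto (fun s => M ^ s) atTop (𝓝 0) := by
  refine tendsto_pi_nhds.2 fun i => tendsto_pi_nhds.2 fun j => ?_
  simpa using tendsto_pi_nhds.1 (h (Pi.single j 1)) i

open scoped Matrix.Norms.Operator in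
theorem abs_dot_le (W : Matrix (Fin a) (Fin a) ℝ) (x : Fin a → ℝ) :
    |x ⬝ᵥ W *ᵥ x| ≤ a * ‖W‖ * ‖x‖ ^ 2 := by
  calc |x ⬝ᵥ W *ᵥ x| ≤ ∑ i, |x i * (W *ᵥ x) i| := Finset.abs_sum_le_sum_abs _ _
    _ ≤ ∑ _i : Fin a, ‖x‖ * (‖W‖ * ‖x‖) := by
        refine Finset.sum_le_sum fun i _ => ?_
        rw [abs_mul]
        exact mul_le_mul (norm_le_pi_norm x i)
          ((norm_le_pi_norm (W *ᵥ x) i).trans (linfty_opNorm_mulVec W x)) (abs_nonneg _)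
          (norm_nonneg _)
    _ = _ := by simp; ring

end Matrix

open scoped Matrix.Norms.Operator in
/-- Orbits of a Schur stable matrix are dominated by a summable sequence. -/
theorem IsSchurStable.exists_summable {n : ℕ} {M : Matrix (Fin n) (Fin n) ℝ}
    (hM : IsSchurStable M) : ∃ b : ℕ → ℝ, Summable b ∧ (∀ j, 0 ≤ b j) ∧
      ∀ (x : Fin n → ℝ) (j : ℕ), ‖M ^ j *ᵥ x‖ ≤ b j * ‖x‖ := by
  set Mc : Matrix (Fin n) (Fin n) ℂ := M.map (algebraMap ℝ ℂ) with hMc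
  refine ⟨fun j => ‖Mc ^ j‖, ?_, fun j => norm_nonneg _, fun x j => ?_⟩
  -- Gelfand's formula turns a spectral radius below one into eventual geometric decay. An empty
  -- spectrum, as for `n = 0`, is handled separately.
  · have hr : spectralRadius ℂ Mc < 1 := by
      rcases (spectrum ℂ Mc).eq_empty_or_nonempty with h | h
      · simp [spectralRadius, h]
      · obtain ⟨z, hz, hz'⟩ := spectrum.exists_nnnorm_eq_spectralRadius_of_nonempty h
        rw [← hz']
        have := hM z hz
        exact_mod_cast this
    obtain ⟨r, hr1, hr2⟩ := ENNReal.lt_iff_exists_nnreal_btwn.1 hr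
    have hev := (spectrum.pow_nnnorm_pow_one_div_tendsto_nhds_spectralRadius Mc).eventually_lt_const
      hr1
    have hr2' : (r : ℝ) < 1 := by exact_mod_cast hr2
    refine Summable.of_norm_bounded_eventually_nat (summable_geometric_of_lt_one r.2 hr2') ?_
    filter_upwards [hev, eventually_gt_atTop 0] with j hj hj0
    rw [norm_norm]
    have h1 : ((‖Mc ^ j‖₊ : ℝ≥0∞) ^ (1 / (j : ℝ))) ^ (j : ℝ) ≤ (r : ℝ≥0∞) ^ (j : ℝ) :=
      ENNReal.rpow_le_rpow hj.le (by positivity)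
    rw [← ENNReal.rpow_mul, one_div_mul_cancel (by positivity), ENNReal.rpow_one,
      ENNReal.rpow_natCast] at h1
    exact_mod_cast h1
  · have h1 : (fun i => (((M ^ j *ᵥ x) i : ℝ) : ℂ)) = Mc ^ j *ᵥ fun i => ((x i : ℝ) : ℂ) := by
      funext i
      have h2 := (algebraMap ℝ ℂ).map_mulVec (M ^ j) x i
      have h3 : (M ^ j).map (algebraMap ℝ ℂ) = Mc ^ j :=
        map_pow (algebraMap ℝ ℂ).mapMatrix M j
      rw [h3] at h2
      exact h2
    have h4 : ∀ v : Fin n → ℝ, ‖fun i => ((v i : ℝ) : ℂ)‖ = ‖v‖ := fun v => by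
      simp [Pi.norm_def]
    rw [← h4 (M ^ j *ᵥ x), h1, ← h4 x]
    exact linfty_opNorm_mulVec _ _

/-! ### Convergence of the LQG Riccati recursion. -/

namespace LQSystem

variable {n m k N : ℕ} (S : LQSystem n m k N)

/-- The Riccati map of the linear-quadratic regulator. -/
def ric (P : Matrix (Fin n) (Fin n) ℝ) : Matrix (Fin n) (Fin n) ℝ :=
  S.Q + S.Aᵀ * S.G P * P * S.A

/-- The optimal gain for the terminal cost `P`. -/
def gain (P : Matrix (Fin n) (Fin n) ℝ) : Matrix (Fin m) (Fin n) ℝ :=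
  -(S.R⁻¹ * S.Bᵀ * S.G P * P * S.A)

variable {S}

theorem optControl_zero (P : Matrix (Fin n) (Fin n) ℝ) (x : Fin n → ℝ) :
    S.optControl P 0 x = S.gain P *ᵥ x := by
  simp [optControl, gain, neg_mulVec, ← mulVec_mulVec]

/-- Together with `ric_le` this says that the Riccati form minimizes over linear feedbacks and that
`gain` attains the minimum; the comparisons of Riccati iterates play a suitable gain in one and
evaluate in the other. -/
theorem ric_eq (hR : S.R.PosDef) {P : Matrix (Fin n) (Fin n) ℝ} (hP : P.PosSemidef)
    (x : Fin n → ℝ) : x ⬝ᵥ S.ric P *ᵥ x = S.stageCost x (S.gain P *ᵥ x)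
      + ((S.A + S.B * S.gain P) *ᵥ x) ⬝ᵥ P *ᵥ ((S.A + S.B * S.gain P) *ᵥ x) := by
  have h := control_identity_opt hR hP 0 x
  simp only [QuadFun.eval, mulVec_zero, zero_dotProduct, mul_zero, neg_zero, add_zero,
    optControl_zero] at h
  rw [ric, add_mulVec, dotProduct_add, ← h, stageCost, add_mulVec, ← mulVec_mulVec]
  ring

theorem ric_le (hR : S.R.PosDef) {P : Matrix (Fin n) (Fin n) ℝ} (hP : P.PosSemidef)
    (K : Matrix (Fin m) (Fin n) ℝ) (x : Fin n → ℝ) : x ⬝ᵥ S.ric P *ᵥ x ≤ S.stageCost x (K *ᵥ x)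
      + ((S.A + S.B * K) *ᵥ x) ⬝ᵥ P *ᵥ ((S.A + S.B * K) *ᵥ x) := by
  have h := control_le hR hP 0 x (K *ᵥ x)
  simp only [QuadFun.eval, mulVec_zero, zero_dotProduct, mul_zero, neg_zero, add_zero] at h
  rw [ric, add_mulVec, dotProduct_add, stageCost, add_mulVec S.A, ← mulVec_mulVec x S.B K]
  linarith

theorem posSemidef_ric (hQ : S.Q.PosSemidef) (hR : S.R.PosDef) {P : Matrix (Fin n) (Fin n) ℝ}
    (hP : P.PosSemidef) : (S.ric P).PosSemidef :=
  posSemidef_lqgStep (f := ⟨P, 0, 0⟩) hQ hR hP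

theorem posSemidef_iterate_ric (hQ : S.Q.PosSemidef) (hR : S.R.PosDef)
    {P : Matrix (Fin n) (Fin n) ℝ} (hP : P.PosSemidef) (s : ℕ) : (S.ric^[s] P).PosSemidef := by
  induction s with
  | zero => exact hP
  | succ s ih => rw [Function.iterate_succ_apply']; exact posSemidef_ric hQ hR ih

theorem lqgP_eq_iterate (s : ℕ) : S.lqgP s = S.ric^[s] S.Qf := by
  induction s with
  | zero => rfl
  | succ s ih => rw [Function.iterate_succ_apply', ← ih]; rfl

theorem ric_mono (hR : S.R.PosDef) {P P' : Matrix (Fin n) (Fin n) ℝ} (hP : P.PosSemidef)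
    (hP' : P'.PosSemidef) (h : ∀ x, x ⬝ᵥ P *ᵥ x ≤ x ⬝ᵥ P' *ᵥ x) (x : Fin n → ℝ) :
    x ⬝ᵥ S.ric P *ᵥ x ≤ x ⬝ᵥ S.ric P' *ᵥ x := by
  rw [ric_eq hR hP']
  refine (ric_le hR hP (S.gain P') x).trans ?_
  gcongr
  exact h _

theorem iterate_ric_mono (hQ : S.Q.PosSemidef) (hR : S.R.PosDef)
    {P P' : Matrix (Fin n) (Fin n) ℝ} (hP : P.PosSemidef)
    (hP' : P'.PosSemidef) (h : ∀ x, x ⬝ᵥ P *ᵥ x ≤ x ⬝ᵥ P' *ᵥ x) (s : ℕ) (x : Fin n → ℝ) :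
    x ⬝ᵥ S.ric^[s] P *ᵥ x ≤ x ⬝ᵥ S.ric^[s] P' *ᵥ x := by
  induction s generalizing x with
  | zero => exact h x
  | succ s ih =>
    rw [Function.iterate_succ_apply', Function.iterate_succ_apply']
    exact ric_mono hR (posSemidef_iterate_ric hQ hR hP s) (posSemidef_iterate_ric hQ hR hP' s) ih x

theorem iterate_ric_le (hQ : S.Q.PosSemidef) (hR : S.R.PosDef) {P : Matrix (Fin n) (Fin n) ℝ}
    (hP : P.PosSemidef) (K : Matrix (Fin m) (Fin n) ℝ) (s : ℕ) (x : Fin n → ℝ) :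
    x ⬝ᵥ S.ric^[s] P *ᵥ x ≤ (∑ j ∈ Finset.range s, S.stageCost ((S.A + S.B * K) ^ j *ᵥ x)
        (K *ᵥ ((S.A + S.B * K) ^ j *ᵥ x)))
      + ((S.A + S.B * K) ^ s *ᵥ x) ⬝ᵥ P *ᵥ ((S.A + S.B * K) ^ s *ᵥ x) := by
  induction s generalizing x with
  | zero => simp
  | succ s ih =>
    rw [Function.iterate_succ_apply', Finset.sum_range_succ']
    have h1 := ric_le hR (posSemidef_iterate_ric hQ hR hP s) K x
    have h2 := ih ((S.A + S.B * K) *ᵥ x)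
    have hpw : ∀ j, (S.A + S.B * K) ^ j *ᵥ ((S.A + S.B * K) *ᵥ x)
        = (S.A + S.B * K) ^ (j + 1) *ᵥ x := fun j => by rw [mulVec_mulVec, pow_succ]
    simp only [hpw] at h2
    simp only [pow_zero, one_mulVec]
    linarith

theorem stageCost_feedback (K : Matrix (Fin m) (Fin n) ℝ) (x : Fin n → ℝ) :
    S.stageCost x (K *ᵥ x) = x ⬝ᵥ (S.Q + Kᵀ * S.R * K) *ᵥ x := by
  rw [stageCost, add_mulVec, dotProduct_add, ← mulVec_mulVec, ← mulVec_mulVec,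
    dotProduct_transpose_mulVec', dotProduct_comm (S.R *ᵥ _)]

theorem tendsto_G (hR : S.R.PosDef) {P : ℕ → Matrix (Fin n) (Fin n) ℝ}
    {L : Matrix (Fin n) (Fin n) ℝ} (h : Tendsto P atTop (𝓝 L)) (hL : L.PosSemidef) :
    Tendsto (fun s => S.G (P s)) atTop (𝓝 (S.G L)) :=
  tendsto_inv (tendsto_const_nhds.add (h.mul tendsto_const_nhds))
    (hL.isUnit_one_add_mul (S.posSemidef_BRB hR))

/-- The Riccati iteration started at zero is bounded. -/
theorem bddAbove_iterate_ric_zero (hQ : S.Q.PosSemidef) (hR : S.R.PosDef)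
    (hstab : Stabilizable S.A S.B) (x : Fin n → ℝ) :
    BddAbove (Set.range fun s => x ⬝ᵥ S.ric^[s] 0 *ᵥ x) := by
  obtain ⟨K, hK⟩ := hstab
  obtain ⟨b, hb, hb0, hbx⟩ := hK.exists_summable
  obtain ⟨D, hD⟩ := hb.tendsto_atTop_zero.bddAbove_range
  obtain ⟨C, hC⟩ : ∃ C : ℝ, ∀ y : Fin n → ℝ, S.stageCost y (K *ᵥ y) ≤ C * ‖y‖ ^ 2 ∧ 0 ≤ C := by
    open scoped Matrix.Norms.Operator in
    exact ⟨n * ‖S.Q + Kᵀ * S.R * K‖, fun y => ⟨by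
      rw [stageCost_feedback]
      exact (le_abs_self _).trans (abs_dot_le _ y), by positivity⟩⟩
  have hC0 := (hC 0).2
  refine ⟨C * (D * ‖x‖ ^ 2) * ∑' j, b j, ?_⟩
  rintro _ ⟨s, rfl⟩
  refine (iterate_ric_le hQ hR .zero K s x).trans ?_
  rw [zero_mulVec, dotProduct_zero, add_zero]
  calc _ ≤ ∑ j ∈ Finset.range s, C * (D * ‖x‖ ^ 2) * b j := by
        refine Finset.sum_le_sum fun j _ => ((hC _).1).trans ?_
        have hDj : b j ≤ D := hD ⟨j, rfl⟩
        have h1 : ‖(S.A + S.B * K) ^ j *ᵥ x‖ ^ 2 ≤ (b j * ‖x‖) ^ 2 := by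
          gcongr
          exact hbx x j
        -- A summable sequence is bounded, so `b j ^ 2 ≤ D * b j` and the quadratic costs are
        -- summable as well.
        have h2 : (b j * ‖x‖) ^ 2 ≤ D * ‖x‖ ^ 2 * b j := by
          have := mul_le_mul_of_nonneg_right hDj (mul_nonneg (hb0 j) (sq_nonneg ‖x‖))
          nlinarith
        rw [mul_assoc]
        exact mul_le_mul_of_nonneg_left (h1.trans h2) hC0
    _ ≤ _ := by
        rw [← Finset.mul_sum]
        have hD0 : 0 ≤ D := (hb0 0).trans (hD ⟨0, rfl⟩)
        exact mul_le_mul_of_nonneg_left (hb.sum_le_tsum _ fun j _ => hb0 j) (by positivity)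

/-- The iterates increase because the first one dominates zero, and stabilizability bounds them;
continuity of the Riccati map makes the limit a fixed point. -/
theorem exists_tendsto_iterate_ric_zero (hQ : S.Q.PosSemidef) (hR : S.R.PosDef)
    (hstab : Stabilizable S.A S.B) : ∃ P : Matrix (Fin n) (Fin n) ℝ, P.PosSemidef ∧
      S.ric P = P ∧ Tendsto (fun s => S.ric^[s] 0) atTop (𝓝 P) := by
  have hpsd : ∀ s, (S.ric^[s] 0).PosSemidef := posSemidef_iterate_ric hQ hR .zero
  obtain ⟨P, hP⟩ := exists_tendsto_of_dot (M := fun s => S.ric^[s] 0)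
    (fun s => (hpsd s).transpose_eq) fun x => by
      refine ⟨_, tendsto_atTop_ciSup (monotone_nat_of_le_succ fun s => ?_)
        (bddAbove_iterate_ric_zero hQ hR hstab x)⟩
      rw [Function.iterate_succ_apply]
      exact iterate_ric_mono hQ hR .zero (posSemidef_ric hQ hR .zero) (fun y => by
        simpa using (posSemidef_ric hQ hR .zero).dot_nonneg y) s x
  have hPp := PosSemidef.of_tendsto hP hpsd
  refine ⟨P, hPp, ?_, hP⟩
  have h1 : Tendsto (fun s => S.ric (S.ric^[s] 0)) atTop (𝓝 (S.ric P)) :=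
    tendsto_const_nhds.add (((tendsto_const_nhds.mul (tendsto_G hR hP hPp)).mul hP).mul
      tendsto_const_nhds)
  have h2 := (tendsto_add_atTop_iff_nat 1).2 hP
  simp_rw [Function.iterate_succ_apply'] at h2
  exact tendsto_nhds_unique h1 h2

theorem mulVec_sqrt_eq_zero {Q : Matrix (Fin n) (Fin n) ℝ} (hQ : Q.PosSemidef) {x : Fin n → ℝ}
    (h : x ⬝ᵥ Q *ᵥ x = 0) : CFC.sqrt Q *ᵥ x = 0 := by
  have h1 : (CFC.sqrt Q).PosSemidef := nonneg_iff_posSemidef.1 (CFC.sqrt_nonneg Q)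
  have h2 : CFC.sqrt Q * CFC.sqrt Q = Q := CFC.sqrt_mul_sqrt_self Q (nonneg_iff_posSemidef.2 hQ)
  rw [← h2, ← mulVec_mulVec, h1.dot_comm] at h
  exact dotProduct_self_eq_zero.1 h

/-- The optimal closed loop is stable. -/
theorem tendsto_closedLoop_pow (hQ : S.Q.PosSemidef) (hR : S.R.PosDef)
    (hobs : Observable S.A (CFC.sqrt S.Q)) {P : Matrix (Fin n) (Fin n) ℝ} (hP : P.PosSemidef)
    (hfix : S.ric P = P) :
    Tendsto (fun s => (S.A + S.B * S.gain P) ^ s) atTop (𝓝 0) := by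
  set K := S.gain P with hK
  set M := S.A + S.B * K with hM
  have hpsdW : (S.Q + Kᵀ * S.R * K).PosSemidef := by
    have := hR.posSemidef.conjTranspose_mul_mul_same K
    rw [conjTranspose_eq_transpose_of_trivial] at this
    exact hQ.add this
  -- `W` is the cost of `n` closed-loop steps. If it vanishes at `x`, all controls vanish, the orbit
  -- is the open-loop one, and observability forces `x = 0`.
  set W := ∑ j ∈ Finset.range n, (M ^ j)ᵀ * (S.Q + Kᵀ * S.R * K) * M ^ j with hW
  have hWx : ∀ x, x ⬝ᵥ W *ᵥ x
      = ∑ j ∈ Finset.range n, S.stageCost (M ^ j *ᵥ x) (K *ᵥ (M ^ j *ᵥ x)) := by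
    intro x
    rw [hW, sum_mulVec, dotProduct_sum]
    refine Finset.sum_congr rfl fun j _ => ?_
    rw [stageCost_feedback, ← mulVec_mulVec, ← mulVec_mulVec, dotProduct_transpose_mulVec',
      dotProduct_comm]
  have hdec : ∀ x, x ⬝ᵥ P *ᵥ x = S.stageCost x (K *ᵥ x) + (M *ᵥ x) ⬝ᵥ P *ᵥ (M *ᵥ x) := by
    intro x
    have := ric_eq hR hP x
    rwa [hfix] at this
  have hWpos : W.PosDef := by
    refine posDef_of_dot ?_ fun x hx => ?_
    · rw [hW, transpose_sum]
      refine Finset.sum_congr rfl fun j _ => ?_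
      rw [transpose_mul, transpose_mul, transpose_transpose, hpsdW.transpose_eq]
      exact (Matrix.mul_assoc _ _ _).symm
    · rw [hWx]
      refine (Finset.sum_nonneg fun j _ => S.stageCost_nonneg hQ hR _ _).lt_of_ne fun h0 => hx ?_
      have hz := (Finset.sum_eq_zero_iff_of_nonneg
        fun j _ => S.stageCost_nonneg hQ hR _ _).1 h0.symm
      have hzero : ∀ j < n, (M ^ j *ᵥ x) ⬝ᵥ S.Q *ᵥ (M ^ j *ᵥ x) = 0 ∧ K *ᵥ (M ^ j *ᵥ x) = 0 := by
        intro j hj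
        have h1 := hz j (Finset.mem_range.2 hj)
        rw [stageCost] at h1
        have h2 := hQ.dot_nonneg (M ^ j *ᵥ x)
        have h3 := hR.posSemidef.dot_nonneg (K *ᵥ (M ^ j *ᵥ x))
        refine ⟨by linarith, ?_⟩
        by_contra hne
        have h4 := hR.dot_pos hne
        linarith
      have hAj : ∀ j < n, M ^ j *ᵥ x = S.A ^ j *ᵥ x := by
        intro j
        induction j with
        | zero => simp
        | succ j ih =>
          intro hj
          have h1 := (hzero j (by omega)).2
          rw [pow_succ', ← mulVec_mulVec, hM, add_mulVec, ← mulVec_mulVec, ← hM, h1, mulVec_zero,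
            add_zero, ih (by omega), mulVec_mulVec, ← pow_succ']
      refine hobs x fun j hj => ?_
      rw [← mulVec_mulVec, ← hAj j hj]
      exact mulVec_sqrt_eq_zero hQ (hzero j hj).1
  refine tendsto_pow_zero_of_mulVec fun x => hWpos.tendsto_zero ?_
  have hstep : ∀ s, (M ^ (s + 1) *ᵥ x) = M *ᵥ (M ^ s *ᵥ x) := fun s => by
    rw [mulVec_mulVec, pow_succ']
  -- `P` is a Lyapunov function that drops by the stage cost. Hence stage costs tend to zero, and so
  -- does `W` along the orbit.
  have hanti : Antitone fun s => (M ^ s *ᵥ x) ⬝ᵥ P *ᵥ (M ^ s *ᵥ x) := by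
    refine antitone_nat_of_succ_le fun s => ?_
    rw [hstep, hdec (M ^ s *ᵥ x)]
    linarith [S.stageCost_nonneg hQ hR (M ^ s *ᵥ x) (K *ᵥ (M ^ s *ᵥ x))]
  have hlim := tendsto_atTop_ciInf hanti
    ⟨0, by rintro _ ⟨s, rfl⟩; exact hP.dot_nonneg _⟩
  have hcost : Tendsto (fun s => S.stageCost (M ^ s *ᵥ x) (K *ᵥ (M ^ s *ᵥ x))) atTop (𝓝 0) := by
    have h1 := hlim.sub ((tendsto_add_atTop_iff_nat 1).2 hlim)
    rw [sub_self] at h1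
    refine h1.congr fun s => ?_
    rw [hstep, hdec (M ^ s *ᵥ x)]
    ring
  simp_rw [hWx, mulVec_mulVec x, ← pow_add]
  have h2 := tendsto_finsetSum (Finset.range n) fun j _ => (tendsto_add_atTop_iff_nat j).2 hcost
  simpa [add_comm] using h2

/-- Convergence of the Riccati recursion of the standard LQG problem. -/
theorem exists_tendsto_lqgP (hQ : S.Q.PosSemidef) (hQf : S.Qf.PosSemidef) (hR : S.R.PosDef)
    (hstab : Stabilizable S.A S.B) (hobs : Observable S.A (CFC.sqrt S.Q)) :
    ∃ P : Matrix (Fin n) (Fin n) ℝ, P.PosSemidef ∧ Tendsto S.lqgP atTop (𝓝 P) ∧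
      Tendsto (fun s => (S.A + S.B * S.gain P) ^ s) atTop (𝓝 0) := by
  obtain ⟨P, hP, hfix, hlim⟩ := exists_tendsto_iterate_ric_zero hQ hR hstab
  have hpow := tendsto_closedLoop_pow hQ hR hobs hP hfix
  refine ⟨P, hP, ?_, hpow⟩
  set M := S.A + S.B * S.gain P with hM
  have hpsd := posSemidef_iterate_ric hQ hR hQf
  simp_rw [funext S.lqgP_eq_iterate]
  refine tendsto_of_dot (fun s => (hpsd s).transpose_eq) hP.transpose_eq fun x => ?_
  -- Playing the stationary gain against the terminal weight `Qf` costs only the correction `Qf - P`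
  -- carried by `M ^ s`, which vanishes. The iteration from zero serves as the lower bound.
  have hub : ∀ s (x : Fin n → ℝ), x ⬝ᵥ S.ric^[s] S.Qf *ᵥ x ≤ x ⬝ᵥ P *ᵥ x
      + (M ^ s *ᵥ x) ⬝ᵥ (S.Qf - P) *ᵥ (M ^ s *ᵥ x) := by
    intro s
    induction s with
    | zero => intro x; simp [sub_mulVec]
    | succ s ih =>
      intro x
      rw [Function.iterate_succ_apply']
      have h1 := ric_le hR (hpsd s) (S.gain P) x
      have h2 := ih (M *ᵥ x)
      have h3 := ric_eq hR hP x
      rw [hfix] at h3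
      have hpw : M ^ s *ᵥ (M *ᵥ x) = M ^ (s + 1) *ᵥ x := by rw [mulVec_mulVec, pow_succ]
      rw [hpw] at h2
      rw [← hM] at h1 h3
      linarith
  have hMx : Tendsto (fun s => M ^ s *ᵥ x) atTop (𝓝 0) := by
    have := ((by fun_prop : Continuous fun L : Matrix (Fin n) (Fin n) ℝ => L *ᵥ x).tendsto 0).comp
      hpow
    simpa [Function.comp_def] using this
  have hres : Tendsto (fun s => x ⬝ᵥ P *ᵥ x + (M ^ s *ᵥ x) ⬝ᵥ (S.Qf - P) *ᵥ (M ^ s *ᵥ x)) atTop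
      (𝓝 (x ⬝ᵥ P *ᵥ x)) := by
    have := ((by fun_prop : Continuous fun v : Fin n → ℝ => v ⬝ᵥ (S.Qf - P) *ᵥ v).tendsto 0).comp
      hMx
    simpa [Function.comp_def] using tendsto_const_nhds.add this
  exact tendsto_of_tendsto_of_tendsto_of_le_of_le (tendsto_dot hlim x) hres
    (fun s => iterate_ric_mono hQ hR .zero hQf (fun y => by simpa using hQf.dot_nonneg y) s x)
    (fun s => hub s x)

end LQSystem

/-! ### Asymptotically autonomous linear recursions. -/

theorem tendsto_zero_of_contraction {a ε : ℕ → ℝ} {k S₀ : ℕ} (hk : 0 < k) (ha : ∀ s, 0 ≤ a s)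
    (hε : Tendsto ε atTop (𝓝 0)) (h : ∀ s ≥ S₀, a (s + k) ≤ 1 / 2 * a s + ε s) :
    Tendsto a atTop (𝓝 0) := by
  refine Metric.tendsto_atTop.2 fun δ hδ => ?_
  -- The level `δ / 2` is the fixed point of `a ↦ a / 2 + δ / 4`; the other half of `δ` is left for
  -- the geometric term.
  obtain ⟨S₁, hS₁⟩ := eventually_atTop.1 (hε.eventually_lt_const (by positivity : (0 : ℝ) < δ / 4))
  set S := max S₀ S₁
  have hSS₀ : S₀ ≤ S := le_max_left _ _
  have hSS₁ : S₁ ≤ S := le_max_right _ _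
  set A := ∑ i ∈ Finset.range k, a (S + i)
  have hA : 0 ≤ A := Finset.sum_nonneg fun i _ => ha _
  have key : ∀ j, ∀ i < k, a (S + i + j * k) ≤ A * (1 / 2) ^ j + δ / 2 := by
    intro j i hi
    induction j with
    | zero =>
      have := Finset.single_le_sum (f := fun i => a (S + i)) (fun i _ => ha _) (Finset.mem_range.2 hi)
      simp only [zero_mul, add_zero, pow_zero, mul_one]
      linarith
    | succ j ih =>
      have h1 := h (S + i + j * k) (by omega)
      have h2 := hS₁ (S + i + j * k) (by omega)
      rw [add_one_mul, ← add_assoc, pow_succ]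
      linarith
  obtain ⟨J, hJ⟩ := ((tendsto_pow_atTop_nhds_zero_of_lt_one (by norm_num : (0 : ℝ) ≤ 1 / 2)
    (by norm_num)).const_mul A |>.eventually_lt_const (by simpa using half_pos hδ : A * 0 < δ / 2)).exists
  refine ⟨S + J * k, fun t ht => ?_⟩
  rw [Real.dist_0_eq_abs, abs_of_nonneg (ha t)]
  have h1 := key ((t - S) / k) ((t - S) % k) (Nat.mod_lt _ hk)
  have h2 : S + (t - S) % k + (t - S) / k * k = t := by
    have := Nat.mod_add_div' (t - S) k
    have : S ≤ t := le_trans (by omega) ht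
    omega
  have h3 : J ≤ (t - S) / k := (Nat.le_div_iff_mul_le hk).2 (by omega)
  have h4 : A * (1 / 2 : ℝ) ^ ((t - S) / k) ≤ A * (1 / 2) ^ J :=
    mul_le_mul_of_nonneg_left (pow_le_pow_of_le_one (by norm_num) (by norm_num) h3) hA
  rw [h2] at h1
  linarith

namespace Matrix

variable {a : ℕ}

theorem tendsto_mulVec {M : ℕ → Matrix (Fin a) (Fin a) ℝ} {L : Matrix (Fin a) (Fin a) ℝ}
    {x : ℕ → Fin a → ℝ} {y : Fin a → ℝ} (hM : Tendsto M atTop (𝓝 L))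
    (hx : Tendsto x atTop (𝓝 y)) : Tendsto (fun s => M s *ᵥ x s) atTop (𝓝 (L *ᵥ y)) :=
  ((by fun_prop : Continuous fun p : Matrix (Fin a) (Fin a) ℝ × (Fin a → ℝ) =>
    p.1 *ᵥ p.2).tendsto (L, y)).comp (hM.prodMk_nhds hx)

open scoped Matrix.Norms.Operator in
/-- An asymptotically autonomous stable linear recursion converges. -/
theorem exists_tendsto_of_recursion {M : ℕ → Matrix (Fin a) (Fin a) ℝ}
    {L : Matrix (Fin a) (Fin a) ℝ} {q r : ℕ → Fin a → ℝ} {q₀ : Fin a → ℝ}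
    (hM : Tendsto M atTop (𝓝 L)) (hq : Tendsto q atTop (𝓝 q₀))
    (hL : Tendsto (fun s => L ^ s) atTop (𝓝 0)) (hr : ∀ s, r (s + 1) = M s *ᵥ r s + q s) :
    ∃ r₀, Tendsto r atTop (𝓝 r₀) := by
  have hu : IsUnit (1 - L) := by
    rw [← mulVec_injective_iff_isUnit]
    refine (injective_iff_map_eq_zero (1 - L).mulVecLin).2 fun y hy => ?_
    rw [mulVecLin_apply, sub_mulVec, one_mulVec, sub_eq_zero] at hy
    have hy' : ∀ s, L ^ s *ᵥ y = y := by
      intro s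
      induction s with
      | zero => simp
      | succ s ih => rw [pow_succ, ← mulVec_mulVec, ← hy, ih]
    have h1 := tendsto_mulVec hL (tendsto_const_nhds (x := y))
    simp_rw [hy', zero_mulVec] at h1
    exact tendsto_nhds_unique tendsto_const_nhds h1
  obtain ⟨r₀, hr₀⟩ : ∃ r₀, r₀ = L *ᵥ r₀ + q₀ := by
    refine ⟨(1 - L)⁻¹ *ᵥ q₀, ?_⟩
    have h := congrArg (· *ᵥ q₀) (mul_nonsing_inv _ ((isUnit_iff_isUnit_det _).1 hu))
    simp only [← mulVec_mulVec, sub_mulVec, one_mulVec] at h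
    rw [← sub_eq_iff_eq_add']
    exact h
  refine ⟨r₀, ?_⟩
  set d : ℕ → Fin a → ℝ := fun s => r s - r₀ with hd
  -- The norm of `L` may exceed one, so the error is followed over `K` steps at a time, with `K`
  -- chosen later so that `‖L ^ K‖ < 1 / 2`.
  have hstep : ∀ K : ℕ, ∃ (P : ℕ → Matrix (Fin a) (Fin a) ℝ) (e : ℕ → Fin a → ℝ),
      Tendsto P atTop (𝓝 (L ^ K)) ∧ Tendsto e atTop (𝓝 0) ∧
        ∀ s, d (s + K) = P s *ᵥ d s + e s := by
    intro K
    induction K with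
    | zero => exact ⟨fun _ => 1, fun _ => 0, tendsto_const_nhds, tendsto_const_nhds, by simp⟩
    | succ K ih =>
      obtain ⟨P, e, hP, he, hde⟩ := ih
      have hMK := (tendsto_add_atTop_iff_nat K).2 hM
      have hqK := (tendsto_add_atTop_iff_nat K).2 hq
      refine ⟨fun s => M (s + K) * P s,
        fun s => M (s + K) *ᵥ e s + (M (s + K) *ᵥ r₀ + q (s + K) - r₀), ?_, ?_, fun s => ?_⟩
      · rw [pow_succ']
        exact hMK.mul hP
      · have := (tendsto_mulVec hMK he).add
          (((tendsto_mulVec hMK (tendsto_const_nhds (x := r₀))).add hqK).sub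
            (tendsto_const_nhds (x := r₀)))
        rwa [mulVec_zero, ← hr₀, sub_self, add_zero] at this
      · have h1 : d (s + (K + 1)) = M (s + K) *ᵥ d (s + K)
            + (M (s + K) *ᵥ r₀ + q (s + K) - r₀) := by
          simp only [hd]
          rw [← add_assoc, hr, mulVec_sub]
          abel
        rw [h1, hde, mulVec_add, mulVec_mulVec]
        rw [add_assoc]
  have hnorm : Tendsto (fun s => ‖L ^ s‖) atTop (𝓝 0) := by simpa using hL.norm
  obtain ⟨K, hK, hK0⟩ := ((hnorm.eventually_lt_const (by norm_num : (0 : ℝ) < 1 / 2)).and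
    (eventually_gt_atTop 0)).exists
  obtain ⟨P, e, hP, he, hde⟩ := hstep K
  obtain ⟨S₀, hS₀⟩ := eventually_atTop.1 (hP.norm.eventually_lt_const hK)
  have hd0 : Tendsto (fun s => ‖d s‖) atTop (𝓝 0) := by
    refine tendsto_zero_of_contraction (ε := fun s => ‖e s‖) (S₀ := S₀) hK0
      (fun s => norm_nonneg _) (by simpa using he.norm) fun s hs => ?_
    rw [hde]
    refine (norm_add_le _ _).trans ?_
    gcongr
    refine (linfty_opNorm_mulVec _ _).trans ?_
    gcongr
    exact (hS₀ s hs).le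
  have h1 := (tendsto_zero_iff_norm_tendsto_zero.2 hd0).add_const r₀
  simpa [hd] using h1

end Matrix

/-! ### The stationary cost. -/

namespace LQSystem

variable {n m k N : ℕ} {S : LQSystem n m k N}

/-- Convergence of the linear coefficient of the LQG value function. -/
theorem exists_tendsto_lqgr (hR : S.R.PosDef) {P : Matrix (Fin n) (Fin n) ℝ} (hP : P.PosSemidef)
    (hlim : Tendsto S.lqgP atTop (𝓝 P))
    (hpow : Tendsto (fun s => (S.A + S.B * S.gain P) ^ s) atTop (𝓝 0)) :
    ∃ r, Tendsto S.lqgr atTop (𝓝 r) := by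
  have hM : Tendsto (fun s => S.Aᵀ * S.G (S.lqgP s)) atTop (𝓝 (S.Aᵀ * S.G P)) :=
    tendsto_const_nhds.mul (tendsto_G hR hlim hP)
  -- The limiting matrix of the recursion for `r` is the transposed optimal closed loop, so its
  -- stability is already known.
  have hcl : S.Aᵀ * S.G P = (S.A + S.B * S.gain P)ᵀ := by
    have h1 : S.A + S.B * S.gain P = (S.G P)ᵀ * S.A := by
      rw [transpose_G hR hP, gain, BRB, Matrix.mul_neg, Matrix.sub_mul, Matrix.one_mul,
        ← sub_eq_add_neg]
      simp only [Matrix.mul_assoc]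
    rw [h1, transpose_mul, transpose_transpose]
  refine exists_tendsto_of_recursion hM (q := fun s => (S.Aᵀ * S.G (S.lqgP s)) *ᵥ
    (S.lqgP s *ᵥ (S.Xi *ᵥ S.wbar))) (tendsto_mulVec hM (tendsto_mulVec hlim tendsto_const_nhds))
    ?_ fun s => ?_
  · rw [hcl]
    simp_rw [← transpose_pow]
    have := ((by fun_prop : Continuous fun L : Matrix (Fin n) (Fin n) ℝ => Lᵀ).tendsto 0).comp hpow
    simpa [Function.comp_def] using this
  · rw [lqgr, mulVec_add, add_comm, ← mulVec_mulVec (S.wbar)]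
    rfl

theorem tendsto_lqgAverageCost (hR : S.R.PosDef) {P : Matrix (Fin n) (Fin n) ℝ}
    (hP : P.PosSemidef) (hlim : Tendsto S.lqgP atTop (𝓝 P)) {r : Fin n → ℝ}
    (hr : Tendsto S.lqgr atTop (𝓝 r)) :
    Tendsto (fun s => S.lqgAverageCost (S.lqgP s) (S.lqgr s)) atTop
      (𝓝 (S.lqgAverageCost P r)) := by
  have hG := tendsto_G hR hlim hP
  -- Treating the inverse as an independent variable makes the expression polynomial.
  have hc : Continuous fun p : Matrix (Fin n) (Fin n) ℝ × Matrix (Fin n) (Fin n) ℝ × (Fin n → ℝ) =>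
      (S.Xiᵀ * p.1 * S.Xi * S.Sigma).trace
      - S.wbar ⬝ᵥ (S.Xiᵀ * p.1 * S.BRB * p.2.1 * p.1 * S.Xi) *ᵥ S.wbar
      + ((2 : ℝ) • (S.Xi *ᵥ S.wbar) - S.BRBᵀ *ᵥ p.2.2) ⬝ᵥ (p.2.1 *ᵥ p.2.2) := by
    fun_prop
  have h := (hc.tendsto (P, S.G P, r)).comp (hlim.prodMk_nhds (hG.prodMk_nhds hr))
  simpa only [Function.comp_def, lqgAverageCost, G] using h

theorem lqgValue_z (T : ℕ) : (S.lqgValue T).z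
    = ∑ s ∈ Finset.range T, S.lqgAverageCost (S.lqgP s) (S.lqgr s) := by
  induction T with
  | zero => rfl
  | succ T ih => rw [Finset.sum_range_succ, ← ih, ← lqgValue_P, ← lqgValue_r]; rfl

/-- The quadratic and linear parts converge and disappear on division by `T`; the constant is a sum
of convergent increments. -/
theorem tendsto_lqgValue_div (hR : S.R.PosDef) {P : Matrix (Fin n) (Fin n) ℝ}
    (hP : P.PosSemidef) (hlim : Tendsto S.lqgP atTop (𝓝 P)) {r : Fin n → ℝ}
    (hr : Tendsto S.lqgr atTop (𝓝 r)) (x : Fin n → ℝ) :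
    Tendsto (fun T : ℕ => (S.lqgValue T).eval x / T) atTop (𝓝 (S.lqgAverageCost P r)) := by
  have h1 := (tendsto_lqgAverageCost hR hP hlim hr).cesaro
  have h2 : Tendsto (fun T => x ⬝ᵥ S.lqgP T *ᵥ x + 2 * (S.lqgr T ⬝ᵥ x)) atTop
      (𝓝 (x ⬝ᵥ P *ᵥ x + 2 * (r ⬝ᵥ x))) :=
    (tendsto_dot hlim x).add ((((by fun_prop : Continuous fun v : Fin n → ℝ => v ⬝ᵥ x).tendsto
      r).comp hr).const_mul 2)
  have h3 := h2.mul tendsto_inv_atTop_nhds_zero_nat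
  have h4 := h3.add h1
  rw [mul_zero, zero_add] at h4
  refine h4.congr fun T => ?_
  rw [QuadFun.eval, lqgValue_P, lqgValue_r, lqgValue_z]
  ring

theorem exists_feasible_lt {c : EReal} (h : S.lamHat2 < c) :
    ∃ l : ℝ, S.Feasible l ∧ (l : EReal) < c := by
  obtain ⟨_, ⟨l, ⟨hl0, hl⟩, rfl⟩, hlc⟩ := sInf_lt_iff.1 h
  refine ⟨l, ⟨hl0, fun s => ?_⟩, hlc⟩
  -- Horizon `s + 1` at time `1` has `s` stages to go, so the constraint `1 ≤ t` loses no index.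
  simpa [gap] using hl (s + 1) (by omega) 1 le_rfl (by omega)

theorem antitone_stationaryCost (x : Fin n → ℝ) : Antitone fun lam => S.stationaryCost lam x := by
  intro lam lam' h
  refine limsup_le_limsup (.of_forall fun T => iInf_mono fun π => iSup_mono fun γ => ?_)
  refine EReal.div_le_div_right_of_nonneg (by positivity) (EReal.sub_le_sub le_rfl ?_)
  exact EReal.coe_ennreal_le_coe_ennreal_iff.2 (by gcongr)

theorem le_stationaryCost (hN : 0 < N) (hQ : S.Q.PosSemidef) (hQf : S.Qf.PosSemidef)
    (hR : S.R.PosDef) {lam ℓ : ℝ} (hlam : 0 ≤ lam) {x : Fin n → ℝ}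
    (hℓ : Tendsto (fun T : ℕ => (S.lqgValue T).eval x / T) atTop (𝓝 ℓ)) :
    (ℓ : EReal) ≤ S.stationaryCost lam x := by
  rw [← ((continuous_coe_real_ereal.tendsto ℓ).comp hℓ).limsup_eq]
  exact limsup_le_limsup (.of_forall fun T => lqgValue_le_minimaxValue hN hQ hQf hR hlam T x)

theorem stationaryCost_le (hN : 0 < N) (hQ : S.Q.PosSemidef) (hQf : S.Qf.PosSemidef)
    (hR : S.R.PosDef) {l lam ℓ : ℝ} (hl : S.Feasible l) (hlam : l < lam) {x : Fin n → ℝ}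
    (hℓ : Tendsto (fun T : ℕ => (S.lqgValue T).eval x / T) atTop (𝓝 ℓ)) :
    S.stationaryCost lam x ≤ ((lam / (lam - l) * ℓ : ℝ) : EReal) := by
  rw [← ((continuous_coe_real_ereal.tendsto _).comp (hℓ.const_mul (lam / (lam - l)))).limsup_eq]
  refine limsup_le_limsup (.of_forall fun T => ?_)
  simp only [Function.comp_apply]
  rw [minimaxValue_eq hN hQ hQf hR hl hlam.le, EReal.coe_le_coe_iff, mul_div_assoc']
  gcongr
  exact robustValue_le hN hQ hQf hR hl hlam T x

/-- The real value of the stationary cost. -/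
def stationaryCostReal (S : LQSystem n m k N) (lam : ℝ) (x : Fin n → ℝ) : ℝ :=
  (S.stationaryCost lam x).toReal

theorem coe_stationaryCostReal (hN : 0 < N) (hQ : S.Q.PosSemidef) (hQf : S.Qf.PosSemidef)
    (hR : S.R.PosDef) {l lam ℓ : ℝ} (hl : S.Feasible l) (hlam : l < lam) {x : Fin n → ℝ}
    (hℓ : Tendsto (fun T : ℕ => (S.lqgValue T).eval x / T) atTop (𝓝 ℓ)) :
    ((S.stationaryCostReal lam x : ℝ) : EReal) = S.stationaryCost lam x :=
  EReal.coe_toReal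
    ((stationaryCost_le hN hQ hQf hR hl hlam hℓ).trans_lt (EReal.coe_lt_top _)).ne
    ((EReal.bot_lt_coe _).trans_le
      (le_stationaryCost hN hQ hQf hR (hl.1.trans hlam).le hℓ)).ne'

/-- Joint convexity of the stationary cost in the penalty parameter and the initial state. -/
theorem stationaryCostReal_convex (hN : 0 < N) (hQ : S.Q.PosSemidef) (hQf : S.Qf.PosSemidef)
    (hR : S.R.PosDef) {l l1 l2 ℓ : ℝ} (hl : S.Feasible l) (h1 : l < l1) (h2 : l < l2)
    (hℓ : ∀ x, Tendsto (fun T : ℕ => (S.lqgValue T).eval x / T) atTop (𝓝 ℓ))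
    {α β : ℝ} (hα : 0 ≤ α) (hβ : 0 ≤ β) (hαβ : α + β = 1) (x y : Fin n → ℝ) :
    S.stationaryCostReal (α * l1 + β * l2) (α • x + β • y)
      ≤ α * S.stationaryCostReal l1 x + β * S.stationaryCostReal l2 y := by
  have hlam : l < α * l1 + β * l2 := (convex_Ioi l) h1 h2 hα hβ hαβ
  -- Both upper bounds hold for all large `T` at once, so the limits superior add up correctly
  -- without any limit existing.
  have hev : ∀ (lam : ℝ) (x : Fin n → ℝ) (ε : ℝ), l < lam → 0 < ε →
      ∀ᶠ T : ℕ in atTop, (S.robustValue lam T).eval x / T < S.stationaryCostReal lam x + ε := by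
    intro lam x ε hlam hε
    have hlt : S.stationaryCost lam x < ((S.stationaryCostReal lam x + ε : ℝ) : EReal) := by
      rw [← coe_stationaryCostReal hN hQ hQf hR hl hlam (hℓ x), EReal.coe_lt_coe_iff]
      linarith
    filter_upwards [eventually_lt_of_limsup_lt hlt] with T hT
    rwa [minimaxValue_eq hN hQ hQf hR hl hlam.le, EReal.coe_lt_coe_iff] at hT
  refine le_of_forall_pos_le_add fun ε hε => ?_
  rw [← EReal.coe_le_coe_iff, coe_stationaryCostReal hN hQ hQf hR hl hlam (hℓ _)]
  refine limsup_le_of_le (by isBoundedDefault) ?_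
  filter_upwards [hev l1 x ε h1 hε, hev l2 y ε h2 hε] with T hT1 hT2
  rw [minimaxValue_eq hN hQ hQf hR hl hlam.le, EReal.coe_le_coe_iff]
  have hc := robustValue_convex hN hQ hQf hR hl h1.le h2.le hα hβ hαβ T x y
  calc _ ≤ (α * (S.robustValue l1 T).eval x + β * (S.robustValue l2 T).eval y) / T := by gcongr
    _ = α * ((S.robustValue l1 T).eval x / T) + β * ((S.robustValue l2 T).eval y / T) := by ring
    _ ≤ α * (S.stationaryCostReal l1 x + ε) + β * (S.stationaryCostReal l2 y + ε) := by gcongr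
    _ = _ := by linear_combination ε * hαβ

/-- The stationary cost does not depend on the initial state. -/
theorem stationaryCostReal_le (hN : 0 < N) (hQ : S.Q.PosSemidef) (hQf : S.Qf.PosSemidef)
    (hR : S.R.PosDef) {l lam ℓ : ℝ} (hl : S.Feasible l) (hlam : l < lam)
    (hℓ : ∀ x, Tendsto (fun T : ℕ => (S.lqgValue T).eval x / T) atTop (𝓝 ℓ))
    (x y : Fin n → ℝ) : S.stationaryCostReal lam x ≤ S.stationaryCostReal lam y := by
  have hlo : ∀ z, ℓ ≤ S.stationaryCostReal lam z := fun z => by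
    rw [← EReal.coe_le_coe_iff, coe_stationaryCostReal hN hQ hQf hR hl hlam (hℓ z)]
    exact le_stationaryCost hN hQ hQf hR (hl.1.trans hlam).le (hℓ z)
  have hup : ∀ z, S.stationaryCostReal lam z ≤ lam / (lam - l) * ℓ := fun z => by
    rw [← EReal.coe_le_coe_iff, coe_stationaryCostReal hN hQ hQf hR hl hlam (hℓ z)]
    exact stationaryCost_le hN hQ hQf hR hl hlam (hℓ z)
  -- A bounded convex function is constant: `x` is a combination of `y` and the remote point `y +
  -- θ⁻¹ (x - y)`, where the uniform bound applies; then `θ → 0`.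
  have key : ∀ θ ∈ Set.Ioo (0 : ℝ) 1, S.stationaryCostReal lam x
      ≤ S.stationaryCostReal lam y + θ * (lam / (lam - l) * ℓ - ℓ) := by
    rintro θ ⟨h0, h1⟩
    have h := stationaryCostReal_convex hN hQ hQf hR hl hlam hlam hℓ (sub_nonneg.2 h1.le) h0.le
      (sub_add_cancel 1 θ) y (y + θ⁻¹ • (x - y))
    have e1 : (1 - θ) * lam + θ * lam = lam := by ring
    have e2 : (1 - θ) • y + θ • (y + θ⁻¹ • (x - y)) = x := by
      rw [smul_add, smul_smul, mul_inv_cancel₀ h0.ne']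
      module
    rw [e1, e2] at h
    have h2 := mul_le_mul_of_nonneg_left (hup (y + θ⁻¹ • (x - y))) h0.le
    have h3 := mul_le_mul_of_nonneg_left (hlo y) h0.le
    linarith
  have hlim : Tendsto (fun θ : ℝ => S.stationaryCostReal lam y + θ * (lam / (lam - l) * ℓ - ℓ))
      (𝓝[>] 0) (𝓝 (S.stationaryCostReal lam y)) := by
    have : Continuous fun θ : ℝ => S.stationaryCostReal lam y + θ * (lam / (lam - l) * ℓ - ℓ) := by
      fun_prop
    simpa using (this.tendsto 0).mono_left nhdsWithin_le_nhds
  exact ge_of_tendsto hlim (by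
    filter_upwards [Ioo_mem_nhdsGT one_pos] with θ hθ using key θ hθ)

theorem tendsto_stationaryCost (hN : 0 < N) (hQ : S.Q.PosSemidef) (hQf : S.Qf.PosSemidef)
    (hR : S.R.PosDef) {l ℓ : ℝ} (hl : S.Feasible l) {x : Fin n → ℝ}
    (hℓ : Tendsto (fun T : ℕ => (S.lqgValue T).eval x / T) atTop (𝓝 ℓ)) :
    Tendsto (fun lam : ℝ => S.stationaryCost lam x) atTop (𝓝 (ℓ : EReal)) := by
  have h1 : Tendsto (fun lam : ℝ => lam / (lam - l) * ℓ) atTop (𝓝 ℓ) := by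
    have h2 : Tendsto (fun lam : ℝ => (1 + l * (lam - l)⁻¹) * ℓ) atTop (𝓝 ((1 + l * 0) * ℓ)) :=
      ((((tendsto_inv_atTop_zero.comp (tendsto_atTop_add_const_right _ (-l) tendsto_id)).const_mul
        l).const_add 1).mul_const ℓ)
    rw [mul_zero, add_zero, one_mul] at h2
    refine h2.congr' ?_
    filter_upwards [eventually_gt_atTop l] with lam hlam
    have : lam - l ≠ 0 := (sub_pos.2 hlam).ne'
    field_simp
    ring
  refine tendsto_of_tendsto_of_tendsto_of_le_of_le' tendsto_const_nhds
    ((continuous_coe_real_ereal.tendsto _).comp h1) ?_ ?_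
  · filter_upwards [eventually_ge_atTop 0] with lam hlam
    exact le_stationaryCost hN hQ hQf hR hlam hℓ
  · filter_upwards [eventually_gt_atTop l] with lam hlam
    exact stationaryCost_le hN hQ hQf hR hl hlam hℓ

end LQSystem

end

theorem mainTheorem10 {n m k N : ℕ} (hN : 0 < N) (S : LQSystem n m k N)
    (hQ : S.Q.PosSemidef) (hQf : S.Qf.PosSemidef) (hR : S.R.PosDef)
    (hstab : Stabilizable S.A S.B)
    (hobs : Observable S.A (CFC.sqrt S.Q))
    (hfin : S.lamHat2 < ⊤) :
    (∃ ρ : ℝ → ℝ,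
      (∀ lam : ℝ, S.lamHatInf < (lam : EReal) →
        ∀ x : Fin n → ℝ, S.stationaryCost lam x = (ρ lam : EReal)) ∧
      AntitoneOn ρ {lam : ℝ | S.lamHatInf < (lam : EReal)} ∧
      ConvexOn ℝ {lam : ℝ | S.lamHatInf < (lam : EReal)} ρ) ∧
    ∃ (P : Matrix (Fin n) (Fin n) ℝ) (r : Fin n → ℝ),
      Tendsto S.lqgP atTop (𝓝 P) ∧
      Tendsto S.lqgr atTop (𝓝 r) ∧
      ∀ x : Fin n → ℝ, Tendsto (fun lam : ℝ => S.stationaryCost lam x) atTop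
        (𝓝 ((S.lqgAverageCost P r : ℝ) : EReal)) := by
  obtain ⟨P, hP, hlim, hpow⟩ := LQSystem.exists_tendsto_lqgP hQ hQf hR hstab hobs
  obtain ⟨r, hr⟩ := LQSystem.exists_tendsto_lqgr hR hP hlim hpow
  have hℓ := LQSystem.tendsto_lqgValue_div hR hP hlim hr
  obtain ⟨l₀, hl₀, -⟩ := LQSystem.exists_feasible_lt hfin
  have hlow : ∀ lam : ℝ, S.lamHatInf < lam → ∃ l, S.Feasible l ∧ l < lam := fun lam h => by
    obtain ⟨l, hl, hl'⟩ := LQSystem.exists_feasible_lt ((le_max_right _ _).trans_lt h)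
    exact ⟨l, hl, EReal.coe_lt_coe_iff.1 hl'⟩
  have hcoe : ∀ lam : ℝ, S.lamHatInf < lam → ∀ x,
      S.stationaryCost lam x = ((S.stationaryCostReal lam 0 : ℝ) : EReal) := fun lam h x => by
    obtain ⟨l, hl, hlam⟩ := hlow lam h
    rw [← LQSystem.coe_stationaryCostReal hN hQ hQf hR hl hlam (hℓ x), EReal.coe_eq_coe_iff]
    exact le_antisymm (LQSystem.stationaryCostReal_le hN hQ hQf hR hl hlam hℓ x 0)
      (LQSystem.stationaryCostReal_le hN hQ hQf hR hl hlam hℓ 0 x)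
  refine ⟨⟨fun lam => S.stationaryCostReal lam 0, hcoe, fun a ha b hb hab => ?_, ?_⟩,
    P, r, hlim, hr, fun x => LQSystem.tendsto_stationaryCost hN hQ hQf hR hl₀ (hℓ x)⟩
  · have h := LQSystem.antitone_stationaryCost (S := S) 0 hab
    simp only [hcoe a ha, hcoe b hb] at h
    exact EReal.coe_le_coe_iff.1 h
  · refine ⟨fun a ha b hb α β hα hβ hαβ => ?_, fun a ha b hb α β hα hβ hαβ => ?_⟩
    · have hmin : min a b ≤ α * a + β * b := by
        calc min a b = α * min a b + β * min a b := by rw [← add_mul, hαβ, one_mul]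
          _ ≤ _ := by gcongr; exacts [min_le_left _ _, min_le_right _ _]
      have h : S.lamHatInf < ((min a b : ℝ) : EReal) := by
        rcases min_choice a b with h | h <;> rw [h] <;> assumption
      exact h.trans_le (EReal.coe_le_coe_iff.2 hmin)
    -- Joint convexity needs one feasible `l` below both parameters, hence the minimum.
    · have h : S.lamHatInf < ((min a b : ℝ) : EReal) := by
        rcases min_choice a b with h | h <;> rw [h] <;> assumption
      obtain ⟨l, hl, hlm⟩ := hlow _ h
      have := LQSystem.stationaryCostReal_convex hN hQ hQf hR hl (hlm.trans_le (min_le_left _ _))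
        (hlm.trans_le (min_le_right _ _)) hℓ hα hβ hαβ 0 0
      simpa using this
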